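/- Let $x_\pm,\kappa_\pm\in\mathbb R$ and let $\gamma\in\mathbb C$ satisfy $\operatorname{Re}\gamma\neq 0$ and $\operatorname{Im}\gamma\notin 2\pi\mathbb Z$. Put $S_+=(x_+,\infty)\times(0,1)$ and $S_-=(-\infty,x_-)\times(0,1)$. For $g\in L^2(0,1)$ let $g_k=\int_0^1 g(z)e^{-2\pi i k z}\,dz$, $k\in\mathbb Z$, and for $s\ge 0$ let $H^s([0,1])$ be the (periodic) Sobolev space of all $g\in L^2(0,1)$ with $$\|g\|_{H^s([0,1])}^2=\sum_{k\in\mathbb Z}\bigl(1+(2\pi k)^2\bigr)^s|g_k|^2<\infty .$$ For each choice of the sign $\pm$ and a given $g$ consider the exterior problem of finding $w\in H^1(S_\pm)$ with $$\Delta w+2\gamma w_z+(\gamma^2+\kappa_\pm^2)w=0\ \text{ in } S_\pm,\qquad w(x,0)=w(x,1),\quad w_z(x,0)=w_z(x,1),\quad w(x_\pm,z)=g(z),$$ understood in the weak sense: $w(\cdot,0)=w(\cdot,1)$ and $w(x_\pm,\cdot)=g$ hold in the sense of $L^2$-traces, and $$\int_{S_\pm}\bigl(-w_x\varphi_x-w_z\varphi_z+2\gamma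 w_z\varphi+(\gamma^2+\kappa_\pm^2)w\varphi\bigr)\,dx\,dz=0$$ for all smooth $\varphi$ that are $1$-periodic in $z$ and have compact support in $x$ inside $(x_+,\infty)$, respectively $(-\infty,x_-)$. Define further $$\beta_{\pm,k}(\gamma)=(\gamma+2\pi i k)^2+\kappa_\pm^2,\qquad s_{\pm,k}(\gamma)=\operatorname{sign}\bigl(\operatorname{Im}\beta_{\pm,k}(\gamma)\bigr)\,i\sqrt{\beta_{\pm,k}(\gamma)}$$ (principal square root) and the Dirichlet-to-Neumann maps $$\mathcal T_{\pm,\gamma}[g](z)=\sum_{k\in\mathbb Z}s_{\pm,k}(\gamma)\,g_k\,e^{2\pi i k z}.$$ Then for every $g\in H^{1/2}([0,1])$ each of the two exterior problems has a unique solution $w\in H^1(S_\pm)$, and there is a constant $C$ independent of $g$ such that $$\|w\|_{H^1(S_\pm)}\le C\,\|g\|_{H^{1/2}([0,1])}.$$ If moreover $g\in H^1([0,1])$, then the series defining $\mathcal T_{\pm,\gamma}[g]$ converge in $L^2(0,1)$, and the solutions $w$ of the exterior problems on $S_+$ and $S_-$, respectively, satisfy $$\mathcal T_{+,\gamma}[w(x_+,\cdot)]=w_x(x_+,\cdot),\qquad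 \mathcal T_{-,\gamma}[w(x_-,\cdot)]=-w_x(x_-,\cdot),$$ where $w_x(x_\pm,\cdot)$ is the limit of $w_x(x,\cdot)$ in $L^2(0,1)$ as $x\to x_\pm$ in $S_\pm$. -/

import Mathlib

open MeasureTheory Set Filter Topology
open scoped ContDiff

noncomputable section

namespace Waveguide

/-- Lebesgue measure on the unit interval. -/
abbrev unitMeasure : Measure ℝ := volume.restrict (Ioo 0 1)

/-- The half strip `I × (0,1)`; points are written `(x, z)`. -/
def strip (I : Set ℝ) : Set (ℝ × ℝ) := I ×ˢ Ioo 0 1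

/-! ### Sobolev spaces -/

/-- Fourier coefficient `g_k = ∫₀¹ g(z) exp(-2πikz) dz` of a function on `[0,1]`. -/
def fourierCoef (g : ℝ → ℂ) (k : ℤ) : ℂ :=
  ∫ z in Ioo (0 : ℝ) 1, g z * Complex.exp (-(2 * Real.pi * Complex.I * k * z))

/-- The weighted coefficients `(1 + (2πk)²)^s |g_k|²`. -/
def hsTerm (s : ℝ) (g : ℝ → ℂ) (k : ℤ) : ℝ :=
  (1 + (2 * Real.pi * k) ^ 2) ^ s * ‖fourierCoef g k‖ ^ 2

/-- The (periodic) Sobolev space `H^s([0,1])`, `s ≥ 0`, described by Fourier coefficients. -/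
def MemHs (s : ℝ) (g : ℝ → ℂ) : Prop :=
  MemLp g 2 unitMeasure ∧ Summable (hsTerm s g)

/-- The norm of `H^s([0,1])`. -/
def hsNorm (s : ℝ) (g : ℝ → ℂ) : ℝ := Real.sqrt (∑' k : ℤ, hsTerm s g k)

/-- `u'` is the weak derivative of `u` on `Ω` in the direction `v`. -/
def HasWeakDeriv (Ω : Set (ℝ × ℝ)) (v : ℝ × ℝ) (u u' : ℝ × ℝ → ℂ) : Prop :=
  ∀ φ : ℝ × ℝ → ℂ, ContDiff ℝ ∞ φ → HasCompactSupport φ → tsupport φ ⊆ Ω →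
    ∫ p in Ω, u p * fderiv ℝ φ p v = - ∫ p in Ω, u' p * φ p

/-- An element of `H¹(Ω)`, `Ω ⊆ ℝ²` open: a representative `val` of a square integrable function,
together with representatives `dx`, `dz` of its weak partial derivatives, which are square
integrable. The underlying element of `H¹(Ω)` is the class of `val` up to null sets. -/
structure H1 (Ω : Set (ℝ × ℝ)) where
  val : ℝ × ℝ → ℂ
  dx : ℝ × ℝ → ℂ
  dz : ℝ × ℝ → ℂ
  memLp_val : MemLp val 2 (volume.restrict Ω)
  memLp_dx : MemLp dx 2 (volume.restrict Ω)
  memLp_dz : MemLp dz 2 (volume.restrict Ω)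
  weak_dx : HasWeakDeriv Ω (1, 0) val dx
  weak_dz : HasWeakDeriv Ω (0, 1) val dz

/-- The norm of `H¹(Ω)`. -/
def H1.norm {Ω : Set (ℝ × ℝ)} (w : H1 Ω) : ℝ :=
  Real.sqrt ((∫ p in Ω, ‖w.val p‖ ^ 2) + (∫ p in Ω, ‖w.dx p‖ ^ 2) + ∫ p in Ω, ‖w.dz p‖ ^ 2)

/-! ### Traces -/

/-- `u(x₀, ·) = h` in the sense of traces: `h ∈ L²(0,1)` and `u(x, ·) → h` in `L²(0,1)` as `x → x₀` inside `I`.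
The limit is an essential limit (null sets of `x` are disregarded), so that it depends only on the
class of `u` up to null sets. -/
def HasTraceX (I : Set ℝ) (x₀ : ℝ) (u : ℝ × ℝ → ℂ) (h : ℝ → ℂ) : Prop :=
  MemLp h 2 unitMeasure ∧
    Tendsto (fun x => eLpNorm (fun z => u (x, z) - h z) 2 unitMeasure)
      (𝓝[I] x₀ ⊓ ae volume) (𝓝 0)

/-- `u(·, z₀) = t` in the sense of traces: `t ∈ L²(I)` and `u(·, z) → t` in `L²(I)` as `z → z₀`
inside `(0,1)`, again as an essential limit. -/
def HasTraceZ (I : Set ℝ) (z₀ : ℝ) (u : ℝ × ℝ → ℂ) (t : ℝ → ℂ) : Prop :=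
  MemLp t 2 (volume.restrict I) ∧
    Tendsto (fun z => eLpNorm (fun x => u (x, z) - t x) 2 (volume.restrict I))
      (𝓝[Ioo 0 1] z₀ ⊓ ae volume) (𝓝 0)

/-! ### The exterior problem -/

/-- Test functions on the closed half strip: smooth, `1`-periodic in `z`, and supported in
`K × ℝ` for some compact `K ⊆ I`. -/
def IsTest (I : Set ℝ) (φ : ℝ × ℝ → ℂ) : Prop :=
  ContDiff ℝ ∞ φ ∧ (∀ x z, φ (x, z + 1) = φ (x, z)) ∧
    ∃ K : Set ℝ, IsCompact K ∧ K ⊆ I ∧ ∀ x z, x ∉ K → φ (x, z) = 0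

/-- `w ∈ H¹(I × (0,1))` is a (weak) solution of the exterior problem
`Δw + 2γ w_z + (γ² + κ²) w = 0` on `I × (0,1)`, `w(x,0) = w(x,1)`, `w_z(x,0) = w_z(x,1)`,
`w(x₀,z) = g(z)`. As usual for weak solutions, the natural condition `w_z(x,0) = w_z(x,1)` is
expressed, together with the equation, by admitting all test functions that are periodic
in `z`. -/
structure IsExteriorSolution (I : Set ℝ) (x₀ : ℝ) (κ : ℝ) (γ : ℂ) (g : ℝ → ℂ)
    (w : H1 (strip I)) : Prop where
  equation : ∀ φ : ℝ × ℝ → ℂ, IsTest I φ →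
    ∫ p in strip I, (-(w.dx p * fderiv ℝ φ p (1, 0)) - w.dz p * fderiv ℝ φ p (0, 1)
      + 2 * γ * w.dz p * φ p + (γ ^ 2 + (κ : ℂ) ^ 2) * w.val p * φ p) = 0
  periodic : ∃ t : ℝ → ℂ, HasTraceZ I 0 w.val t ∧ HasTraceZ I 1 w.val t
  dirichlet : HasTraceX I x₀ w.val g

/-! ### The Dirichlet-to-Neumann maps -/

/-- `β_k(γ) = (γ + 2πik)² + κ²`. -/
def beta (κ : ℝ) (γ : ℂ) (k : ℤ) : ℂ :=
  (γ + 2 * Complex.I * Real.pi * k) ^ 2 + (κ : ℂ) ^ 2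

/-- `s_k(γ) = sign(Im β_k(γ)) i √β_k(γ)`, with the principal square root. -/
def sCoef (κ : ℝ) (γ : ℂ) (k : ℤ) : ℂ :=
  (Real.sign (beta κ γ k).im : ℂ) * Complex.I * Complex.sqrt (beta κ γ k)

/-- The exponential `z ↦ exp(2πikz)`. -/
def expMode (k : ℤ) (z : ℝ) : ℂ := Complex.exp (2 * Real.pi * Complex.I * k * z)

theorem memLp_expMode (k : ℤ) : MemLp (expMode k) 2 unitMeasure := by
  have hc : Continuous (expMode k) := by unfold expMode; fun_prop
  refine MemLp.of_bound hc.aestronglyMeasurable 1 (ae_of_all _ fun z => ?_)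
  have : expMode k z = Complex.exp ((2 * Real.pi * k * z : ℝ) * Complex.I) := by
    unfold expMode; congr 1; push_cast; ring
  rw [this, Complex.norm_exp_ofReal_mul_I]

/-- The terms `s_k(γ) g_k exp(2πikz)` of the series of `T_γ[g]`, as elements of `L²(0,1)`. -/
def dtnTerm (κ : ℝ) (γ : ℂ) (g : ℝ → ℂ) (k : ℤ) : Lp ℂ 2 unitMeasure :=
  (sCoef κ γ k * fourierCoef g k) • (memLp_expMode k).toLp (expMode k)

/-- The Dirichlet-to-Neumann map `T_γ[g] = ∑_k s_k(γ) g_k exp(2πikz)`, as a series in `L²(0,1)`.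
It is well defined at `g` when the series converges, that is, when `dtnTerm κ γ g` is summable. -/
def dtn (κ : ℝ) (γ : ℂ) (g : ℝ → ℂ) : Lp ℂ 2 unitMeasure := ∑' k : ℤ, dtnTerm κ γ g k

end Waveguide

end

/-! Fourier expansion in `z` decouples the problem. The coefficient `w_k(x)` of a solution satisfies
`w_k'' + β_k w_k = 0` on the half line, and `s_k² = -β_k`. Since `Im β_k = 2 Re γ (Im γ + 2πk)`, the
hypotheses on `γ` say exactly that no `β_k` is real, and the sign in `s_k` then selects the root
with `Re s_k < 0`. With `σ = 1` on the right and `σ = -1` on the left, the only square integrable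
candidate is `w_k(x) = g_k exp(s_k σ (x - x₀))`.

Uniqueness: for an arbitrary weak solution the mode equation is derived by testing with `χ(x)
exp(-2πikz)`. The coefficients of `w_z` are `2πik w_k` only because the traces at `z = 0` and `z =
1` agree (`integral_coefFun_dz`). The second order equation is factored into two first order ones,
and square integrability removes the growing factor (`exists_ae_eq_modeX`). The trace at `x₀` fixes
the remaining constant (`IsExteriorSolution.coefFun_ae_eq`), and Parseval finishes.

Existence: the series of these modes is the solution. The bounds `c⟨k⟩ ≤ -Re s_k`
(`exists_sCoef_re_le`) and `|s_k| ≤ C⟨k⟩` (`exists_norm_sCoef_le`) carry all estimates. A mode has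
squared norm `1 / (2 |Re s_k|)`, of order at most `1/⟨k⟩`, and a derivative costs a factor `⟨k⟩²` in
the square, so the `H¹` norm is controlled by `∑ ⟨k⟩ |g_k|²`, the square of the `H^{1/2}` norm. Away
from `x₀` the series converges exponentially fast, so it may be tested term by term.

Dirichlet-to-Neumann map: `σ w_x` has coefficients `s_k g_k exp(s_k σ (x - x₀))`. For `g ∈ H¹` the
sequence `s_k g_k` is square summable, and dominated convergence in Parseval's identity gives the
limit as `x → x₀` (`hasTraceX_of_coefFun`). -/

noncomputable section

namespace Waveguide

/-! ### The characteristic exponents -/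

/-- The weight `⟨k⟩ = √(1 + (2πk)²)`. -/
def jap (k : ℤ) : ℝ := Real.sqrt (1 + (2 * Real.pi * k) ^ 2)

theorem jap_sq (k : ℤ) : jap k ^ 2 = 1 + (2 * Real.pi * k) ^ 2 :=
  Real.sq_sqrt (by positivity)

theorem one_le_jap (k : ℤ) : 1 ≤ jap k :=
  Real.one_le_sqrt.2 (by nlinarith [sq_nonneg (2 * Real.pi * (k : ℝ))])

theorem jap_pos (k : ℤ) : 0 < jap k := one_pos.trans_le (one_le_jap k)

theorem abs_two_pi_le_jap (k : ℤ) : |2 * Real.pi * (k : ℝ)| ≤ jap k := by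
  refine Real.le_sqrt_of_sq_le ?_
  rw [sq_abs]; linarith

theorem norm_two_pi_I_le_jap (k : ℤ) : ‖(2 * Real.pi * Complex.I * k : ℂ)‖ ≤ jap k := by
  have h : (2 * Real.pi * Complex.I * k : ℂ) = ((2 * Real.pi * k : ℝ) : ℂ) * Complex.I := by
    push_cast; ring
  rw [h, norm_mul, Complex.norm_I, mul_one, Complex.norm_real]
  exact abs_two_pi_le_jap k

theorem hsTerm_half (g : ℝ → ℂ) (k : ℤ) : hsTerm (1 / 2) g k = jap k * ‖fourierCoef g k‖ ^ 2 := by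
  rw [hsTerm, ← Real.sqrt_eq_rpow, jap]

theorem hsTerm_one (g : ℝ → ℂ) (k : ℤ) : hsTerm 1 g k = jap k ^ 2 * ‖fourierCoef g k‖ ^ 2 := by
  rw [hsTerm, Real.rpow_one, jap_sq]

theorem summable_jap_inv_sq : Summable fun k : ℤ => (jap k ^ 2)⁻¹ := by
  have h : Summable fun k : ℤ => 1 / (k : ℝ) ^ 2 := Real.summable_one_div_int_pow.2 one_lt_two
  refine Summable.of_norm_bounded_eventually h ?_
  have h0 : ∀ᶠ k : ℤ in cofinite, k ≠ 0 := (Set.finite_singleton (0 : ℤ)).compl_mem_cofinite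
  filter_upwards [h0] with k hk
  have hk' : (0 : ℝ) < (k : ℝ) ^ 2 := by positivity
  rw [Real.norm_of_nonneg (by positivity), jap_sq, one_div]
  refine inv_anti₀ hk' ?_
  have : 1 ≤ (2 * Real.pi) ^ 2 := by nlinarith [Real.pi_gt_three]
  nlinarith

/-- Exponentially weighted sums of `⟨k⟩²` converge. -/
theorem summable_jap_sq_mul_exp {δ : ℝ} (hδ : 0 < δ) :
    Summable fun k : ℤ => jap k ^ 2 * Real.exp (-(δ * jap k)) := by
  refine Summable.of_nonneg_of_le (fun k => by have := jap_pos k; positivity) (fun k => ?_)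
    (summable_jap_inv_sq.mul_left (24 / δ ^ 4))
  have hj := jap_pos k
  have hy : 0 < δ * jap k := by positivity
  -- The fourth power is what leaves a summable `⟨k⟩⁻²` after the factor `⟨k⟩²`.
  have h := Real.pow_div_factorial_le_exp (δ * jap k) hy.le 4
  rw [Real.exp_neg]
  have h24 : ((4 : ℕ).factorial : ℝ) = 24 := by norm_num [Nat.factorial]
  rw [h24] at h
  have h2 : (Real.exp (δ * jap k))⁻¹ ≤ ((δ * jap k) ^ 4 / 24)⁻¹ := inv_anti₀ (by positivity) h
  calc jap k ^ 2 * (Real.exp (δ * jap k))⁻¹ ≤ jap k ^ 2 * ((δ * jap k) ^ 4 / 24)⁻¹ := by gcongr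
    _ = 24 / δ ^ 4 * (jap k ^ 2)⁻¹ := by field_simp

theorem beta_im (κ : ℝ) (γ : ℂ) (k : ℤ) :
    (beta κ γ k).im = 2 * γ.re * (γ.im + 2 * Real.pi * k) := by
  simp [beta, pow_two]; ring

theorem beta_re (κ : ℝ) (γ : ℂ) (k : ℤ) :
    (beta κ γ k).re = γ.re ^ 2 - (γ.im + 2 * Real.pi * k) ^ 2 + κ ^ 2 := by
  simp [beta, pow_two]

theorem beta_im_ne_zero {κ : ℝ} {γ : ℂ} (hre : γ.re ≠ 0)
    (him : ∀ n : ℤ, γ.im ≠ 2 * Real.pi * n) (k : ℤ) : (beta κ γ k).im ≠ 0 := by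
  rw [beta_im]
  refine mul_ne_zero (mul_ne_zero two_ne_zero hre) fun h => him (-k) ?_
  push_cast; linarith

theorem complex_sqrt_sq (a : ℂ) : Complex.sqrt a ^ 2 = a := by
  simp [Complex.sqrt]

theorem sCoef_sq {κ : ℝ} {γ : ℂ} {k : ℤ} (h : (beta κ γ k).im ≠ 0) :
    sCoef κ γ k ^ 2 = -beta κ γ k := by
  have h1 : (Real.sign (beta κ γ k).im : ℂ) ^ 2 = 1 := by
    rcases Real.sign_apply_eq_of_ne_zero _ h with h | h <;> simp [h]
  rw [sCoef, mul_pow, mul_pow, h1, complex_sqrt_sq, Complex.I_sq]; ring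

/-- With `q = √β` one has `Im β = 2 Re q Im q` and `Re q > 0`, so `Im q` has the sign of `Im β`.
Hence `Re s = -sign(Im β) Im q = -|Im q|`. -/
theorem sCoef_re_neg {κ : ℝ} {γ : ℂ} {k : ℤ} (h : (beta κ γ k).im ≠ 0) :
    (sCoef κ γ k).re < 0 := by
  set b := beta κ γ k with hb
  set q := Complex.sqrt b with hq
  have hq2 : q ^ 2 = b := complex_sqrt_sq b
  have hre : 0 ≤ q.re := by
    rw [hq, Complex.sqrt, Complex.cpow_inv_two_re]; positivity
  have him : b.im = 2 * q.re * q.im := by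
    rw [← hq2]; simp [pow_two]; ring
  have hre' : 0 < q.re := lt_of_le_of_ne hre fun h0 => h (by rw [him, ← h0]; ring)
  have hs : (sCoef κ γ k).re = -(Real.sign b.im * q.im) := by
    simp [sCoef, ← hb, ← hq]
  rw [hs, neg_lt_zero]
  rcases lt_or_gt_of_ne h with h1 | h1
  · rw [Real.sign_of_neg h1]; nlinarith
  · rw [Real.sign_of_pos h1]; nlinarith

/-- The exponents `s_k` decay linearly in `k`. -/
theorem exists_sCoef_re_le {κ : ℝ} {γ : ℂ} (hre : γ.re ≠ 0)
    (him : ∀ n : ℤ, γ.im ≠ 2 * Real.pi * n) :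
    ∃ c : ℝ, 0 < c ∧ ∀ k : ℤ, c * jap k ≤ -(sCoef κ γ k).re := by
  set r := γ.re
  set B := r ^ 2 + κ ^ 2 with hB
  have hr : 0 < r ^ 2 := by positivity
  have hBpos : 0 < B := by positivity
  have hpi := Real.pi_pos
  -- The distance of `Im γ` from `2πℤ`, a lower bound for `|μ_k|` with `μ_k = Im γ + 2πk`. It makes
  -- `|μ_k|` comparable to `⟨k⟩` uniformly in `k`, including small `k`.
  set d := |γ.im / (2 * Real.pi) - round (γ.im / (2 * Real.pi))| * (2 * Real.pi) with hd
  have hdpos : 0 < d := by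
    refine mul_pos (abs_pos.2 fun h => him (round (γ.im / (2 * Real.pi))) ?_) (by positivity)
    have : γ.im / (2 * Real.pi) = round (γ.im / (2 * Real.pi)) := by linarith
    rw [← this]; field_simp
  have hμ : ∀ k : ℤ, d ≤ |γ.im + 2 * Real.pi * k| := fun k => by
    have h := round_le (γ.im / (2 * Real.pi)) (-k)
    have e : γ.im + 2 * Real.pi * k = (γ.im / (2 * Real.pi) - (-k : ℤ)) * (2 * Real.pi) := by
      push_cast; field_simp; ring
    rw [e, abs_mul, abs_of_pos (by positivity : 0 < 2 * Real.pi), hd]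
    gcongr
  set D := (1 + d + |γ.im|) / d with hD
  have hDpos : 0 < D := by positivity
  have hj : ∀ k : ℤ, jap k ≤ D * |γ.im + 2 * Real.pi * k| := fun k => by
    have h1 : jap k ≤ 1 + |2 * Real.pi * (k : ℝ)| := by
      refine Real.sqrt_le_iff.2 ⟨by positivity, ?_⟩
      nlinarith [abs_nonneg (2 * Real.pi * (k : ℝ)), sq_abs (2 * Real.pi * (k : ℝ))]
    have h2 : |2 * Real.pi * (k : ℝ)| ≤ |γ.im + 2 * Real.pi * k| + |γ.im| := by
      calc |2 * Real.pi * (k : ℝ)| = |(γ.im + 2 * Real.pi * k) - γ.im| := by ring_nf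
        _ ≤ _ := abs_sub _ _
    have h3 := hμ k
    have h4 : D * |γ.im + 2 * Real.pi * k| =
      |γ.im + 2 * Real.pi * k| + (1 + |γ.im|) * (|γ.im + 2 * Real.pi * k| / d) := by
      rw [hD]; field_simp; ring
    have h5 : 1 ≤ |γ.im + 2 * Real.pi * k| / d := (one_le_div hdpos).2 h3
    rw [h4]
    nlinarith [abs_nonneg γ.im]
  set e := Real.sqrt (r ^ 2 / (2 * B)) with he
  have hepos : 0 < e := Real.sqrt_pos.2 (by positivity)
  refine ⟨e / D, by positivity, fun k => ?_⟩
  have hbim := beta_im_ne_zero (κ := κ) hre him k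
  have hneg := sCoef_re_neg hbim
  have hsq := sCoef_sq hbim
  set s := sCoef κ γ k
  set μ := γ.im + 2 * Real.pi * k with hμk
  have e1 : s.re ^ 2 - s.im ^ 2 = μ ^ 2 - B := by
    have := congrArg Complex.re hsq
    rw [Complex.neg_re, beta_re] at this
    simp [pow_two] at this
    simp only [hB, hμk]; nlinarith
  have e2 : s.re * s.im = -(r * μ) := by
    have := congrArg Complex.im hsq
    rw [Complex.neg_im, beta_im] at this
    simp [pow_two] at this
    nlinarith
  -- Eliminating `Im s` from the real and imaginary parts of `s² = -β` gives a quadratic equation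
  -- for `(Re s)²`.
  have e3 : s.re ^ 2 * (s.re ^ 2 + B - μ ^ 2) = r ^ 2 * μ ^ 2 := by
    have : s.im ^ 2 = s.re ^ 2 + B - μ ^ 2 := by linarith
    rw [← this, ← mul_pow, e2]; ring
  have e4 : r ^ 2 / (2 * B) * μ ^ 2 ≤ s.re ^ 2 := by
    rw [div_mul_eq_mul_div, div_le_iff₀ (by positivity)]
    have hrB : r ^ 2 ≤ B := by rw [hB]; nlinarith [sq_nonneg κ]
    -- If `(Re s)² ≤ B`, the bracket in `e3` is at most `2B`. Otherwise `μ² ≤ (Re s)² + B < 2 (Re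
    -- s)²`, and `r² ≤ B` suffices.
    rcases le_or_gt (s.re ^ 2) B with h | h
    · nlinarith [sq_nonneg s.re, mul_nonneg (sq_nonneg s.re) (sq_nonneg μ)]
    · have : μ ^ 2 ≤ s.re ^ 2 + B := by nlinarith [sq_nonneg s.im]
      nlinarith [sq_nonneg s.re]
  have e5 : e * |μ| ≤ -s.re := by
    have : e * |μ| = Real.sqrt (r ^ 2 / (2 * B) * μ ^ 2) := by
      rw [Real.sqrt_mul (by positivity), Real.sqrt_sq_eq_abs]
    rw [this]
    refine Real.sqrt_le_iff.2 ⟨by linarith, ?_⟩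
    rw [neg_sq]; exact e4
  calc e / D * jap k ≤ e / D * (D * |μ|) := by gcongr; exact hj k
    _ = e * |μ| := by field_simp
    _ ≤ _ := e5

theorem exists_norm_sCoef_le {κ : ℝ} {γ : ℂ} (hre : γ.re ≠ 0)
    (him : ∀ n : ℤ, γ.im ≠ 2 * Real.pi * n) :
    ∃ C : ℝ, 0 < C ∧ ∀ k : ℤ, ‖sCoef κ γ k‖ ≤ C * jap k := by
  refine ⟨‖γ‖ + 1 + |κ|, by positivity, fun k => ?_⟩
  have hsq := sCoef_sq (beta_im_ne_zero (κ := κ) hre him k)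
  have hj := one_le_jap k
  refine abs_le_of_sq_le_sq' (b := (‖γ‖ + 1 + |κ|) * jap k) ?_ (by positivity) |>.2
  have h1 : ‖γ + 2 * Complex.I * Real.pi * k‖ ≤ (‖γ‖ + 1) * jap k := by
    have e : (2 * Complex.I * Real.pi * k : ℂ) = 2 * Real.pi * Complex.I * k := by ring
    have := norm_two_pi_I_le_jap k
    calc _ ≤ ‖γ‖ + ‖(2 * Complex.I * Real.pi * k : ℂ)‖ := norm_add_le _ _
      _ ≤ ‖γ‖ * jap k + jap k := by
        rw [e]; gcongr; exact le_mul_of_one_le_right (norm_nonneg _) hj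
      _ = _ := by ring
  rw [← norm_pow, hsq, norm_neg]
  calc ‖beta κ γ k‖ ≤ ‖(γ + 2 * Complex.I * Real.pi * k) ^ 2‖ + ‖(κ : ℂ) ^ 2‖ := norm_add_le _ _
    _ = ‖γ + 2 * Complex.I * Real.pi * k‖ ^ 2 + |κ| ^ 2 := by
      rw [norm_pow, norm_pow, Complex.norm_real, Real.norm_eq_abs]
    _ ≤ ((‖γ‖ + 1) * jap k) ^ 2 + (|κ| * jap k) ^ 2 := by
      gcongr; exact le_mul_of_one_le_right (abs_nonneg _) hj
    _ ≤ _ := by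
      have : 0 ≤ (‖γ‖ + 1) * jap k * (|κ| * jap k) := by positivity
      nlinarith

/-! ### Fourier series on the unit interval -/

theorem continuous_expMode (k : ℤ) : Continuous (expMode k) := by
  unfold expMode; fun_prop

theorem contDiff_expMode (k : ℤ) : ContDiff ℝ ∞ (expMode k) := by
  unfold expMode
  exact Complex.contDiff_exp.comp (contDiff_const.mul Complex.ofRealCLM.contDiff)

@[simp] theorem norm_expMode (k : ℤ) (z : ℝ) : ‖expMode k z‖ = 1 := by
  have : expMode k z = Complex.exp ((2 * Real.pi * k * z : ℝ) * Complex.I) := by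
    unfold expMode; congr 1; push_cast; ring
  rw [this, Complex.norm_exp_ofReal_mul_I]

theorem expMode_mul (j k : ℤ) (z : ℝ) : expMode j z * expMode k z = expMode (j + k) z := by
  unfold expMode; rw [← Complex.exp_add]; congr 1; push_cast; ring

@[simp] theorem expMode_zero_left (z : ℝ) : expMode 0 z = 1 := by simp [expMode]

@[simp] theorem expMode_zero (k : ℤ) : expMode k 0 = 1 := by simp [expMode]

@[simp] theorem expMode_one (k : ℤ) : expMode k 1 = 1 := by
  have : (2 * Real.pi * Complex.I * k * (1 : ℝ) : ℂ) = k * (2 * Real.pi * Complex.I) := by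
    push_cast; ring
  rw [expMode, this, Complex.exp_int_mul_two_pi_mul_I]

theorem expMode_add_one (k : ℤ) (z : ℝ) : expMode k (z + 1) = expMode k z := by
  have : expMode k (z + 1) = expMode k z * expMode k 1 := by
    unfold expMode; rw [← Complex.exp_add]; congr 1; push_cast; ring
  rw [this, expMode_one, mul_one]

theorem conj_expMode (k : ℤ) (z : ℝ) : (starRingEnd ℂ) (expMode k z) = expMode (-k) z := by
  unfold expMode
  rw [← Complex.exp_conj]
  congr 1
  simp [Complex.conj_ofNat]

theorem hasDerivAt_expMode (k : ℤ) (z : ℝ) :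
    HasDerivAt (expMode k) (2 * Real.pi * Complex.I * k * expMode k z) z := by
  have h : HasDerivAt (fun z : ℝ => (2 * Real.pi * Complex.I * k * z : ℂ))
      (2 * Real.pi * Complex.I * k) z := by
    simpa using (Complex.ofRealCLM.hasDerivAt (x := z)).const_mul (2 * Real.pi * Complex.I * k : ℂ)
  rw [mul_comm]
  exact h.cexp

theorem fourierCoef_eq (g : ℝ → ℂ) (k : ℤ) :
    fourierCoef g k = ∫ z, g z * expMode (-k) z ∂unitMeasure := by
  refine integral_congr_ae (ae_of_all _ fun z => ?_)
  simp [expMode]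

theorem integral_expMode (k : ℤ) : ∫ z, expMode k z ∂unitMeasure = if k = 0 then 1 else 0 := by
  split_ifs with h
  · subst h
    simp
  · have hc : (2 * Real.pi * Complex.I * k : ℂ) ≠ 0 := by
      simp [h, Real.pi_ne_zero]
    rw [← integral_Ioc_eq_integral_Ioo, ← intervalIntegral.integral_of_le zero_le_one]
    have := integral_exp_mul_complex (a := 0) (b := 1) hc
    unfold expMode
    rw [this]
    have h1 := expMode_one k
    unfold expMode at h1
    rw [h1]
    simp

theorem fourierCoef_expMode (j k : ℤ) : fourierCoef (expMode j) k = if j = k then 1 else 0 := by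
  rw [fourierCoef_eq]
  simp_rw [expMode_mul, integral_expMode, ← sub_eq_add_neg, sub_eq_zero]

theorem integrable_mul_expMode {g : ℝ → ℂ} (hg : Integrable g unitMeasure) (k : ℤ) :
    Integrable (fun z => g z * expMode k z) unitMeasure :=
  hg.mul_bdd (c := 1) (continuous_expMode k).aestronglyMeasurable
    (ae_of_all _ fun z => by simp)

theorem fourierCoef_sub {f g : ℝ → ℂ} (hf : MemLp f 2 unitMeasure) (hg : MemLp g 2 unitMeasure)
    (k : ℤ) : fourierCoef (fun z => f z - g z) k = fourierCoef f k - fourierCoef g k := by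
  simp_rw [fourierCoef_eq, sub_mul]
  exact integral_sub (integrable_mul_expMode (hf.integrable one_le_two) _)
    (integrable_mul_expMode (hg.integrable one_le_two) _)

theorem fourierCoef_congr {f g : ℝ → ℂ} (h : f =ᵐ[unitMeasure] g) (k : ℤ) :
    fourierCoef f k = fourierCoef g k :=
  integral_congr_ae (h.mono fun z hz => by simp only [hz])

theorem hasSum_norm_sq_fourierCoef {g : ℝ → ℂ} (hg : MemLp g 2 unitMeasure) :
    HasSum (fun k => ‖fourierCoef g k‖ ^ 2) (∫ z, ‖g z‖ ^ 2 ∂unitMeasure) := by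
  have hm : (volume.restrict (Ioc 0 1) : Measure ℝ) = unitMeasure :=
    (Measure.restrict_congr_set Ioo_ae_eq_Ioc).symm
  have h := hasSum_sq_fourierCoeffOn (a := 0) (b := 1) (f := g) one_pos (by rwa [hm])
  convert h using 1
  · funext k
    congr 2
    rw [fourierCoeffOn_eq_integral, fourierCoef_eq, intervalIntegral.integral_of_le zero_le_one, hm]
    simp only [sub_zero, div_one, one_smul]
    refine integral_congr_ae (ae_of_all _ fun z => ?_)
    simp only [smul_eq_mul, fourier_coe_apply]
    rw [mul_comm]
    congr 1
    unfold expMode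
    congr 1
    push_cast; ring
  · rw [intervalIntegral.integral_of_le zero_le_one, hm]
    simp

/-- Parseval with values in `[0, ∞]`, so that sums and integrals can later be exchanged without
summability side conditions. -/
theorem lintegral_enorm_sq {g : ℝ → ℂ} (hg : MemLp g 2 unitMeasure) :
    ∫⁻ z, ‖g z‖ₑ ^ 2 ∂unitMeasure = ∑' k, ‖fourierCoef g k‖ₑ ^ 2 := by
  have h := hasSum_norm_sq_fourierCoef hg
  have e : ∀ a : ℂ, ‖a‖ₑ ^ 2 = ENNReal.ofReal (‖a‖ ^ 2) := fun a => by
    rw [ENNReal.ofReal_pow (norm_nonneg _), ofReal_norm]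
  simp_rw [e]
  rw [← ENNReal.ofReal_tsum_of_nonneg (fun k => sq_nonneg _) h.summable, h.tsum_eq,
    ofReal_integral_eq_lintegral_ofReal (by simpa using hg.integrable_norm_pow two_ne_zero)
      (ae_of_all _ fun z => sq_nonneg _)]

theorem eLpNorm_two_sq {α : Type*} [MeasurableSpace α] (μ : Measure α) (g : α → ℂ) :
    eLpNorm g 2 μ ^ 2 = ∫⁻ z, ‖g z‖ₑ ^ 2 ∂μ := by
  have := eLpNorm_nnreal_pow_eq_lintegral (μ := μ) (f := g) (p := 2) two_ne_zero
  simpa using this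

theorem memLp_two_of_lintegral_lt_top {α : Type*} [MeasurableSpace α] {μ : Measure α} {g : α → ℂ}
    (hm : AEStronglyMeasurable g μ) (h : ∫⁻ z, ‖g z‖ₑ ^ 2 ∂μ < ⊤) : MemLp g 2 μ := by
  refine ⟨hm, ?_⟩
  rw [← eLpNorm_two_sq] at h
  by_contra hc
  rw [not_lt, top_le_iff] at hc
  simp [hc] at h

theorem lintegral_enorm_sq_lt_top {α : Type*} [MeasurableSpace α] {μ : Measure α}
    {g : α → ℂ} (h : MemLp g 2 μ) : ∫⁻ z, ‖g z‖ₑ ^ 2 ∂μ < ⊤ := by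
  rw [← eLpNorm_two_sq]
  exact ENNReal.pow_lt_top h.2

/-- Completeness of the exponentials, read off from Parseval for the difference. -/
theorem ae_eq_of_fourierCoef_eq {f g : ℝ → ℂ} (hf : MemLp f 2 unitMeasure)
    (hg : MemLp g 2 unitMeasure) (h : ∀ k, fourierCoef f k = fourierCoef g k) :
    f =ᵐ[unitMeasure] g := by
  have h0 : ∫⁻ z, ‖f z - g z‖ₑ ^ 2 ∂unitMeasure = 0 := by
    have := lintegral_enorm_sq (hf.sub hg)
    simp only [Pi.sub_apply] at this
    rw [this]
    have hz : ∀ k, fourierCoef (f - g) k = 0 := fun k => by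
      rw [show f - g = fun z => f z - g z from rfl, fourierCoef_sub hf hg, h, sub_self]
    simp [hz]
  have h0 := (lintegral_eq_zero_iff' ((hf.1.sub hg.1).enorm.pow_const 2)).1 h0
  filter_upwards [h0] with z hz
  simpa [sub_eq_zero] using hz

theorem enorm_fourierCoef_le {g : ℝ → ℂ} (hg : MemLp g 2 unitMeasure) (k : ℤ) :
    ‖fourierCoef g k‖ₑ ≤ eLpNorm g 2 unitMeasure := by
  have h : ‖fourierCoef g k‖ₑ ^ 2 ≤ eLpNorm g 2 unitMeasure ^ 2 := by
    rw [eLpNorm_two_sq, lintegral_enorm_sq hg]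
    exact ENNReal.le_tsum k
  exact (ENNReal.pow_le_pow_left_iff two_ne_zero).1 h

/-! ### The series of the Dirichlet-to-Neumann map -/

theorem inner_expMode (k : ℤ) (f : Lp ℂ 2 unitMeasure) :
    inner ℂ ((memLp_expMode k).toLp (expMode k)) f = fourierCoef f k := by
  rw [L2.inner_def, fourierCoef_eq]
  refine integral_congr_ae ?_
  filter_upwards [(memLp_expMode k).coeFn_toLp] with z hz
  simp [hz, conj_expMode]

theorem orthonormal_expMode :
    Orthonormal ℂ fun k => (memLp_expMode k).toLp (expMode k) := by
  rw [orthonormal_iff_ite]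
  intro i j
  rw [inner_expMode, fourierCoef_congr (memLp_expMode j).coeFn_toLp, fourierCoef_expMode]
  simp [eq_comm]

theorem summable_smul_expMode {a : ℤ → ℂ} (ha : Summable fun k => ‖a k‖ ^ 2) :
    Summable fun k => a k • (memLp_expMode k).toLp (expMode k) := by
  have := (orthonormal_expMode.orthogonalFamily.summable_iff_norm_sq_summable a).2 ha
  simpa using this

theorem fourierCoef_tsum_smul_expMode {a : ℤ → ℂ} (ha : Summable fun k => ‖a k‖ ^ 2) (k : ℤ) :
    fourierCoef (∑' j, a j • (memLp_expMode j).toLp (expMode j) : Lp ℂ 2 unitMeasure) k = a k := by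
  rw [← inner_expMode]
  have h := (summable_smul_expMode ha).hasSum
  have h2 := h.mapL (innerSL ℂ ((memLp_expMode k).toLp (expMode k)))
  simp only [innerSL_apply_apply, inner_smul_right,
    orthonormal_iff_ite.1 orthonormal_expMode] at h2
  have e : (fun j => a j * if k = j then (1 : ℂ) else 0) = fun j => if j = k then a k else 0 := by
    funext j
    rcases eq_or_ne k j with rfl | hj
    · simp
    · simp [hj, hj.symm]
  rw [e] at h2
  exact h2.unique (hasSum_ite_eq k (a k))

/-! ### Weak derivatives on an interval -/

/-- Smooth functions with compact support in `I`. -/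
structure IsBump (I : Set ℝ) (χ : ℝ → ℂ) : Prop where
  contDiff : ContDiff ℝ ∞ χ
  compact : HasCompactSupport χ
  subset : tsupport χ ⊆ I

theorem IsBump.continuous {I : Set ℝ} {χ : ℝ → ℂ} (h : IsBump I χ) : Continuous χ :=
  h.contDiff.continuous

theorem IsBump.differentiable {I : Set ℝ} {χ : ℝ → ℂ} (h : IsBump I χ) : Differentiable ℝ χ :=
  h.contDiff.differentiable (by simp)

theorem IsBump.deriv {I : Set ℝ} {χ : ℝ → ℂ} (h : IsBump I χ) : IsBump I (deriv χ) :=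
  ⟨(contDiff_infty_iff_deriv.1 h.contDiff).2, h.compact.deriv, tsupport_deriv_subset.trans h.subset⟩

theorem IsBump.mul_left {I : Set ℝ} {χ e : ℝ → ℂ} (h : IsBump I χ) (he : ContDiff ℝ ∞ e) :
    IsBump I (fun x => e x * χ x) :=
  ⟨he.mul h.contDiff, h.compact.mul_left, tsupport_mul_subset_right.trans h.subset⟩

theorem integrable_mul_of_hasCompactSupport {μ : Measure ℝ} {f χ : ℝ → ℂ}
    (hf : LocallyIntegrable f μ) (hc : Continuous χ) (h : HasCompactSupport χ) :
    Integrable (fun x => f x * χ x) μ := by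
  simpa [mul_comm] using hf.integrable_smul_left_of_hasCompactSupport hc h

/-- A smooth function with compact support in an interval `I` and integral zero is the derivative
of such a function. -/
theorem exists_antideriv_of_integral_eq_zero {I : Set ℝ} (hI : I.OrdConnected) {ψ : ℝ → ℝ}
    (hψ : ContDiff ℝ ∞ ψ) (hc : HasCompactSupport ψ) (hs : tsupport ψ ⊆ I) (h0 : ∫ x, ψ x = 0) :
    ∃ χ : ℝ → ℝ, ContDiff ℝ ∞ χ ∧ HasCompactSupport χ ∧ tsupport χ ⊆ I ∧ deriv χ = ψ := by
  rcases (tsupport ψ).eq_empty_or_nonempty with he | hne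
  · have hz : ψ = 0 := tsupport_eq_empty_iff.1 he
    exact ⟨0, contDiff_const, HasCompactSupport.zero, by simp, by simp [hz]⟩
  obtain ⟨a, ha⟩ := IsCompact.exists_isLeast hc hne
  obtain ⟨b, hb⟩ := IsCompact.exists_isGreatest hc hne
  have hab : a ≤ b := ha.2 hb.1
  have hψa : ∀ x < a, ψ x = 0 := fun x hx =>
    image_eq_zero_of_notMem_tsupport fun h => (ha.2 h).not_gt hx
  have hψb : ∀ x, b < x → ψ x = 0 := fun x hx =>
    image_eq_zero_of_notMem_tsupport fun h => (hb.2 h).not_gt hx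
  have hcont := hψ.continuous
  -- The primitive starting at the left end of the support. It vanishes beyond the right end because
  -- the total integral is zero, and `[a, b] ⊆ I` by order connectedness.
  set χ : ℝ → ℝ := fun x => ∫ y in a..x, ψ y with hχ
  have hder : deriv χ = ψ := funext fun x => hcont.deriv_integral ψ a x
  have hdiff : Differentiable ℝ χ := fun x =>
    (hcont.integral_hasStrictDerivAt a x).hasDerivAt.differentiableAt
  have hab0 : ∫ y in a..b, ψ y = 0 := by
    rw [intervalIntegral.integral_of_le hab, ← integral_Icc_eq_integral_Ioc, ← h0]
    refine setIntegral_eq_integral_of_forall_compl_eq_zero fun x hx => ?_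
    rw [mem_Icc, not_and_or, not_le, not_le] at hx
    exact hx.elim (hψa x) (hψb x)
  have hχa : ∀ x < a, χ x = 0 := fun x hx => by
    simp only [hχ]
    rw [intervalIntegral.integral_symm, intervalIntegral.integral_of_le hx.le,
      integral_Ioc_eq_integral_Ioo,
      setIntegral_eq_zero_of_forall_eq_zero fun y hy => hψa y hy.2, neg_zero]
  have hχb : ∀ x, b < x → χ x = 0 := fun x hx => by
    simp only [hχ]
    rw [← intervalIntegral.integral_add_adjacent_intervals (hcont.intervalIntegrable a b)
      (hcont.intervalIntegrable b x), hab0, zero_add, intervalIntegral.integral_of_le hx.le,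
      setIntegral_eq_zero_of_forall_eq_zero fun y hy => hψb y hy.1]
  have hsupp : Function.support χ ⊆ Icc a b := fun x hx => by
    by_contra hcon
    rw [mem_Icc, not_and_or, not_le, not_le] at hcon
    exact hx (hcon.elim (hχa x) (hχb x))
  refine ⟨χ, contDiff_infty_iff_deriv.2 ⟨hdiff, by rwa [hder]⟩,
    HasCompactSupport.of_support_subset_isCompact isCompact_Icc hsupp,
    (closure_minimal hsupp isClosed_Icc).trans (hI.out (hs ha.1) (hs hb.1)), hder⟩

/-- **Du Bois-Reymond**: a function on an interval with vanishing weak derivative is constant. -/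
theorem ae_eq_const_of_integral_mul_deriv_eq_zero {I : Set ℝ} (hI : IsOpen I)
    (hc : I.OrdConnected) (hne : I.Nonempty) {f : ℝ → ℂ}
    (hf : LocallyIntegrable f (volume.restrict I))
    (h : ∀ χ : ℝ → ℂ, IsBump I χ → ∫ x in I, f x * deriv χ x = 0) :
    ∃ c : ℂ, ∀ᵐ x ∂volume.restrict I, f x = c := by
  obtain ⟨x₁, hx₁⟩ := hne
  obtain ⟨ε, hε, hball⟩ := Metric.isOpen_iff.1 hI x₁ hx₁
  let B : ContDiffBump x₁ := ⟨ε / 4, ε / 2, by positivity, by linarith⟩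
  set ψ₀ : ℝ → ℝ := B.normed volume with hψ₀
  have hψ₀d : ContDiff ℝ ∞ ψ₀ := B.contDiff_normed
  have hψ₀c : HasCompactSupport ψ₀ := B.hasCompactSupport_normed
  have hψ₀s : tsupport ψ₀ ⊆ I := by
    rw [hψ₀, B.tsupport_normed_eq]
    exact (Metric.closedBall_subset_ball (by show ε / 2 < ε; linarith)).trans hball
  have hψ₀i : ∫ x, ψ₀ x = 1 := B.integral_normed
  have toI : ∀ ψ : ℝ → ℝ, tsupport ψ ⊆ I → ∫ x in I, ψ x = ∫ x, ψ x := fun ψ hs =>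
    setIntegral_eq_integral_of_forall_compl_eq_zero fun x hx =>
      image_eq_zero_of_notMem_tsupport fun hx' => hx (hs hx')
  -- The constant is the mean of `f` against a fixed bump `ψ₀` of mass one. For any test function
  -- `ψ` of integral `m`, the difference `ψ - m ψ₀` has integral zero, so it is the derivative of an
  -- admissible test function.
  set c : ℂ := ∫ x in I, ψ₀ x • f x with hcdef
  refine ⟨c, ?_⟩
  have key := hI.ae_eq_zero_of_integral_contDiff_smul_eq_zero (μ := volume.restrict I)
    (f := fun x => f x - c) ((hf.sub (locallyIntegrable_const c)).locallyIntegrableOn I) ?_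
  · filter_upwards [key, ae_restrict_mem hI.measurableSet] with x hx hxI
    exact sub_eq_zero.1 (hx hxI)
  intro ψ hψ hψc hψs
  set m : ℝ := ∫ x, ψ x with hm
  have hψint : Integrable ψ := hψ.continuous.integrable_of_hasCompactSupport hψc
  have hψ₀int : Integrable ψ₀ := hψ₀d.continuous.integrable_of_hasCompactSupport hψ₀c
  obtain ⟨χ, hχ, hχc, hχs, hχd⟩ := exists_antideriv_of_integral_eq_zero hc
    (ψ := fun x => ψ x - m * ψ₀ x) (hψ.sub (contDiff_const.mul hψ₀d))
    (hψc.sub hψ₀c.mul_left)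
    ((tsupport_sub _ _).trans (union_subset hψs (tsupport_mul_subset_right.trans hψ₀s)))
    (by rw [integral_sub hψint (hψ₀int.const_mul m), integral_const_mul, hψ₀i]; simp [hm])
  have hd : ∀ x, deriv (fun x => (χ x : ℂ)) x = ((ψ x - m * ψ₀ x : ℝ) : ℂ) := fun x => by
    have h1 : HasDerivAt χ (ψ x - m * ψ₀ x) x := by
      have := (hχ.differentiable (by simp) x).hasDerivAt
      rwa [hχd] at this
    exact h1.ofReal_comp.deriv
  have h1 := h (fun x => (χ x : ℂ))
    ⟨Complex.ofRealCLM.contDiff.comp hχ, hχc.comp_left Complex.ofReal_zero,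
      (closure_mono (Function.support_comp_subset Complex.ofReal_zero χ)).trans hχs⟩
  have i1 : Integrable (fun x => ψ x • f x) (volume.restrict I) :=
    hf.integrable_smul_left_of_hasCompactSupport hψ.continuous hψc
  have i2 : Integrable (fun x => ψ₀ x • f x) (volume.restrict I) :=
    hf.integrable_smul_left_of_hasCompactSupport hψ₀d.continuous hψ₀c
  have h2 : ∫ x in I, f x * deriv (fun x => (χ x : ℂ)) x = (∫ x in I, ψ x • f x) - m * c := by
    rw [hcdef, ← integral_const_mul, ← integral_sub i1 (i2.const_mul _)]
    refine integral_congr_ae (ae_of_all _ fun x => ?_)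
    simp only [hd, Complex.real_smul]
    push_cast; ring
  have h3 : ∫ x in I, ψ x • (f x - c) = (∫ x in I, ψ x • f x) - m * c := by
    have : ∫ x in I, ψ x • c = m * c := by
      rw [integral_smul_const, toI ψ hψs, Complex.real_smul]
    rw [← this, ← integral_sub i1 (hψint.integrableOn.smul_const c)]
    simp only [smul_sub]
  rw [h3, ← h2, h1]

/-- Weak solutions of `f' = -a f` are exponentials. -/
theorem ae_eq_const_mul_exp {I : Set ℝ} (hI : IsOpen I)
    (hc : I.OrdConnected) (hne : I.Nonempty) {f : ℝ → ℂ} (a : ℂ) (x₀ : ℝ)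
    (hf : LocallyIntegrable f (volume.restrict I))
    (h : ∀ χ : ℝ → ℂ, IsBump I χ →
      ∫ x in I, f x * deriv χ x = a * ∫ x in I, f x * χ x) :
    ∃ c : ℂ, ∀ᵐ x ∂volume.restrict I, f x = c * Complex.exp (-a * (x - x₀ : ℝ)) := by
  -- Integrating factor: `f e` has vanishing weak derivative, as seen by inserting `e χ` into the
  -- hypothesis.
  set e : ℝ → ℂ := fun x => Complex.exp (a * (x - x₀ : ℝ)) with he
  have hed : ContDiff ℝ ∞ e := by
    refine Complex.contDiff_exp.comp (contDiff_const.mul ?_)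
    exact Complex.ofRealCLM.contDiff.comp (contDiff_id.sub contDiff_const)
  have hderiv : ∀ x, HasDerivAt e (a * e x) x := fun x => by
    have h1 : HasDerivAt (fun x : ℝ => a * ((x - x₀ : ℝ) : ℂ)) a x := by
      simpa using (((hasDerivAt_id x).sub_const x₀).ofReal_comp).const_mul a
    simpa [he, mul_comm] using h1.cexp
  have hfe : LocallyIntegrable (fun x => f x * e x) (volume.restrict I) := by
    rw [← locallyIntegrableOn_univ] at hf ⊢
    exact hf.mul_continuousOn hed.continuous.continuousOn isClosed_univ.isLocallyClosed
  obtain ⟨c, hc'⟩ := ae_eq_const_of_integral_mul_deriv_eq_zero hI hc hne hfe fun χ hχ => by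
    have hb := hχ.mul_left hed
    have h1 := h _ hb
    have hd : ∀ x, deriv (fun x => e x * χ x) x = a * (e x * χ x) + e x * deriv χ x := fun x => by
      have := ((hderiv x).mul (hχ.differentiable x).hasDerivAt).deriv
      rw [show deriv (fun x => e x * χ x) x = _ from this]; ring
    have i1 := integrable_mul_of_hasCompactSupport hf hb.continuous hb.compact
    have i2 := integrable_mul_of_hasCompactSupport hfe hχ.deriv.continuous hχ.deriv.compact
    have h2 : ∫ x in I, f x * deriv (fun x => e x * χ x) x =
        a * (∫ x in I, f x * (e x * χ x)) + ∫ x in I, f x * e x * deriv χ x := by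
      rw [← integral_const_mul, ← integral_add (i1.const_mul a) i2]
      refine integral_congr_ae (ae_of_all _ fun x => ?_)
      simp only [hd]; ring
    rw [h2] at h1
    simpa using h1
  refine ⟨c, hc'.mono fun x hx => ?_⟩
  rw [← hx, mul_assoc, he]
  simp only
  rw [← Complex.exp_add]
  simp

/-! ### Half lines -/

/-- The half line starting at `x₀` in the direction `σ`. -/
def halfLine (σ x₀ : ℝ) : Set ℝ := {x | 0 < σ * (x - x₀)}

theorem halfLine_one (x₀ : ℝ) : halfLine 1 x₀ = Ioi x₀ := by
  ext x; simp [halfLine]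

theorem halfLine_neg_one (x₀ : ℝ) : halfLine (-1) x₀ = Iio x₀ := by
  ext x; simp [halfLine]

theorem isOpen_halfLine (σ x₀ : ℝ) : IsOpen (halfLine σ x₀) :=
  isOpen_lt continuous_const (by fun_prop)

theorem measurableSet_halfLine (σ x₀ : ℝ) : MeasurableSet (halfLine σ x₀) :=
  (isOpen_halfLine σ x₀).measurableSet

theorem ordConnected_halfLine {σ : ℝ} (hσ : σ = 1 ∨ σ = -1) (x₀ : ℝ) :
    (halfLine σ x₀).OrdConnected := by
  rcases hσ with rfl | rfl
  · rw [halfLine_one]; infer_instance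
  · rw [halfLine_neg_one]; infer_instance

theorem nonempty_halfLine {σ : ℝ} (hσ : σ = 1 ∨ σ = -1) (x₀ : ℝ) : (halfLine σ x₀).Nonempty := by
  rcases hσ with rfl | rfl
  · rw [halfLine_one]; exact nonempty_Ioi
  · rw [halfLine_neg_one]; exact nonempty_Iio

theorem volume_halfLine {σ : ℝ} (hσ : σ = 1 ∨ σ = -1) (x₀ : ℝ) : volume (halfLine σ x₀) = ⊤ := by
  rcases hσ with rfl | rfl
  · rw [halfLine_one, Real.volume_Ioi]
  · rw [halfLine_neg_one, Real.volume_Iio]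

theorem mem_closure_halfLine {σ : ℝ} (hσ : σ = 1 ∨ σ = -1) (x₀ : ℝ) :
    x₀ ∈ closure (halfLine σ x₀) := by
  rcases hσ with rfl | rfl
  · rw [halfLine_one, closure_Ioi]; exact self_mem_Ici
  · rw [halfLine_neg_one, closure_Iio]; exact self_mem_Iic

/-- Nonempty open sets have positive measure. This makes essential limits unique. -/
theorem neBot_nhdsWithin_inf_ae {I : Set ℝ} (hI : IsOpen I) {x₀ : ℝ} (hx : x₀ ∈ closure I) :
    (𝓝[I] x₀ ⊓ ae (volume : Measure ℝ)).NeBot := by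
  rw [Filter.inf_neBot_iff]
  intro s hs t ht
  obtain ⟨U, hU, hxU, hUs⟩ := mem_nhdsWithin.1 hs
  have hne : (U ∩ I).Nonempty := mem_closure_iff.1 hx U hU hxU
  have hpos : 0 < volume (U ∩ I) := (hU.inter hI).measure_pos volume hne
  by_contra hcon
  have hsub : U ∩ I ⊆ tᶜ := fun x hx ht' => hcon ⟨x, hUs hx, ht'⟩
  have h0 : volume tᶜ = 0 := mem_ae_iff.1 ht
  exact hpos.ne' (measure_mono_null hsub h0)

/-- The `x`-dependence `exp(s σ (x - x₀))` of a mode. -/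
def modeX (σ x₀ : ℝ) (s : ℂ) (x : ℝ) : ℂ := Complex.exp (s * (σ * (x - x₀) : ℝ))

theorem contDiff_modeX (σ x₀ : ℝ) (s : ℂ) : ContDiff ℝ ∞ (modeX σ x₀ s) := by
  refine Complex.contDiff_exp.comp (contDiff_const.mul ?_)
  exact Complex.ofRealCLM.contDiff.comp (contDiff_const.mul (contDiff_id.sub contDiff_const))

theorem hasDerivAt_modeX (σ x₀ : ℝ) (s : ℂ) (x : ℝ) :
    HasDerivAt (modeX σ x₀ s) (σ * s * modeX σ x₀ s x) x := by
  have h1 : HasDerivAt (fun x : ℝ => s * ((σ * (x - x₀) : ℝ) : ℂ)) (σ * s) x := by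
    simpa [mul_comm] using ((((hasDerivAt_id x).sub_const x₀).const_mul σ).ofReal_comp).const_mul s
  rw [mul_comm]
  exact h1.cexp

theorem norm_modeX (σ x₀ : ℝ) (s : ℂ) (x : ℝ) :
    ‖modeX σ x₀ s x‖ = Real.exp (s.re * (σ * (x - x₀))) := by
  rw [modeX, Complex.norm_exp, Complex.re_mul_ofReal]

/-- Square integrable weak solutions on a half line of `w' = d`, `d' = s² w` are multiples of the
decaying exponential. -/
theorem exists_ae_eq_modeX {σ x₀ : ℝ} (hσ : σ = 1 ∨ σ = -1) {s : ℂ} (hs : s.re < 0) {w d : ℝ → ℂ}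
    (hw : MemLp w 2 (volume.restrict (halfLine σ x₀)))
    (hd : MemLp d 2 (volume.restrict (halfLine σ x₀)))
    (h1 : ∀ χ, IsBump (halfLine σ x₀) χ →
      ∫ x in halfLine σ x₀, w x * deriv χ x = -∫ x in halfLine σ x₀, d x * χ x)
    (h2 : ∀ χ, IsBump (halfLine σ x₀) χ →
      ∫ x in halfLine σ x₀, d x * deriv χ x = -(s ^ 2 * ∫ x in halfLine σ x₀, w x * χ x)) :
    ∃ c : ℂ, (∀ᵐ x ∂volume.restrict (halfLine σ x₀), w x = c * modeX σ x₀ s x) ∧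
      ∀ᵐ x ∂volume.restrict (halfLine σ x₀), d x = σ * s * c * modeX σ x₀ s x := by
  set I := halfLine σ x₀ with hI
  have hσ2 : (σ : ℂ) ^ 2 = 1 := by rcases hσ with rfl | rfl <;> simp
  have hIo : IsOpen I := isOpen_halfLine σ x₀
  have hIc : I.OrdConnected := ordConnected_halfLine hσ x₀
  have hIn : I.Nonempty := nonempty_halfLine hσ x₀
  have hwl := hw.locallyIntegrable one_le_two
  have hdl := hd.locallyIntegrable one_le_two
  -- Factorisation `∂² - s² = (∂ + σs)(∂ - σs)`, using `σ² = 1`: the function `A = w' - σ s w`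
  -- satisfies `A' = -σ s A`.
  set A : ℝ → ℂ := fun x => d x - σ * s * w x with hA
  have hAm : MemLp A 2 (volume.restrict I) := hd.sub (hw.const_mul (σ * s))
  obtain ⟨C, hC⟩ := ae_eq_const_mul_exp hIo hIc hIn (σ * s) x₀ (hAm.locallyIntegrable one_le_two)
    fun χ hχ => by
      have i1 := integrable_mul_of_hasCompactSupport hwl hχ.continuous hχ.compact
      have i2 := integrable_mul_of_hasCompactSupport hdl hχ.continuous hχ.compact
      have i3 := integrable_mul_of_hasCompactSupport hwl hχ.deriv.continuous hχ.deriv.compact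
      have i4 := integrable_mul_of_hasCompactSupport hdl hχ.deriv.continuous hχ.deriv.compact
      simp only [hA, sub_mul, mul_assoc]
      simp only [← mul_assoc (σ : ℂ) s]
      rw [integral_sub i4 (i3.const_mul _), integral_sub i2 (i1.const_mul _), integral_const_mul,
        integral_const_mul, h1 χ hχ, h2 χ hχ]
      linear_combination (s ^ 2 * ∫ x in I, w x * χ x) * hσ2
  -- On the half line the exponential in `A` has modulus at least one because `Re s < 0`. So the
  -- constant `C` would be square integrable on a set of infinite measure.
  have hC0 : C = 0 := by
    have hcm : MemLp (fun _ : ℝ => C) 2 (volume.restrict I) := by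
      refine hAm.mono aestronglyMeasurable_const ?_
      filter_upwards [hC, ae_restrict_mem hIo.measurableSet] with x hx hxI
      rw [hx, norm_mul, Complex.norm_exp]
      refine le_mul_of_one_le_right (norm_nonneg _) (Real.one_le_exp ?_)
      rw [Complex.re_mul_ofReal]
      have hx' : 0 < σ * (x - x₀) := hxI
      simp only [Complex.neg_re, Complex.re_ofReal_mul]
      nlinarith
    rcases (memLp_const_iff (by simp) (by simp)).1 hcm with h | h
    · exact h
    · rw [Measure.restrict_apply_univ, hI, volume_halfLine hσ] at h
      exact absurd h (lt_irrefl _)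
  have hdA : ∀ᵐ x ∂volume.restrict I, d x = σ * s * w x := by
    filter_upwards [hC] with x hx
    rw [hC0, zero_mul] at hx
    exact sub_eq_zero.1 hx
  obtain ⟨c, hc⟩ := ae_eq_const_mul_exp hIo hIc hIn (-(σ * s)) x₀ hwl fun χ hχ => by
      rw [h1 χ hχ, neg_mul, ← integral_const_mul]
      congr 1
      refine integral_congr_ae (hdA.mono fun x hx => ?_)
      simp only [hx]; ring
  have hc' : ∀ᵐ x ∂volume.restrict I, w x = c * modeX σ x₀ s x := by
    filter_upwards [hc] with x hx
    rw [hx, modeX]; congr 2; push_cast; ring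
  refine ⟨c, hc', ?_⟩
  filter_upwards [hc', hdA] with x h h'
  rw [h', h]; ring

/-! ### Cutoff functions on the unit interval -/

/-- A smooth function supported in `[1/n, 1 - 1/n]` and equal to one on `[2/n, 1 - 2/n]`. -/
def cutoff (n : ℕ) (z : ℝ) : ℝ :=
  Real.smoothTransition (n * z - 1) * Real.smoothTransition (n * (1 - z) - 1)

theorem contDiff_cutoff (n : ℕ) : ContDiff ℝ ∞ (cutoff n) := by
  unfold cutoff
  exact (Real.smoothTransition.contDiff.comp (by fun_prop)).mul
    (Real.smoothTransition.contDiff.comp (by fun_prop))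

theorem cutoff_nonneg (n : ℕ) (z : ℝ) : 0 ≤ cutoff n z :=
  mul_nonneg (Real.smoothTransition.nonneg _) (Real.smoothTransition.nonneg _)

theorem cutoff_le_one (n : ℕ) (z : ℝ) : cutoff n z ≤ 1 :=
  mul_le_one₀ (Real.smoothTransition.le_one _) (Real.smoothTransition.nonneg _)
    (Real.smoothTransition.le_one _)

theorem support_cutoff {n : ℕ} (hn : n ≠ 0) :
    Function.support (cutoff n) ⊆ Icc (1 / n : ℝ) (1 - 1 / n) := fun z hz => by
  have hn' : (0 : ℝ) < n := by positivity
  have h1 : Real.smoothTransition (n * z - 1) ≠ 0 := left_ne_zero_of_mul hz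
  have h2 : Real.smoothTransition (n * (1 - z) - 1) ≠ 0 := right_ne_zero_of_mul hz
  rw [Ne, Real.smoothTransition.zero_iff_nonpos, not_le] at h1 h2
  refine ⟨?_, ?_⟩
  · rw [div_le_iff₀ hn']; linarith
  · rw [le_sub_comm, div_le_iff₀ hn']; linarith

theorem isBump_cutoff {n : ℕ} (hn : n ≠ 0) : IsBump (Ioo 0 1) fun z => (cutoff n z : ℂ) := by
  have hn' : (0 : ℝ) < n := by positivity
  have hs : Function.support (fun z => (cutoff n z : ℂ)) ⊆ Icc (1 / n : ℝ) (1 - 1 / n) :=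
    fun z hz => support_cutoff hn fun h => hz (by simp [h])
  refine ⟨Complex.ofRealCLM.contDiff.comp (contDiff_cutoff n),
    HasCompactSupport.of_support_subset_isCompact isCompact_Icc hs,
    (closure_minimal hs isClosed_Icc).trans (Icc_subset_Ioo (by positivity) ?_)⟩
  have : (0 : ℝ) < 1 / n := by positivity
  linarith

theorem cutoff_eq_one {n : ℕ} (hn : n ≠ 0) {z : ℝ} (h1 : 2 / n ≤ z) (h2 : z ≤ 1 - 2 / n) :
    cutoff n z = 1 := by
  have hn' : (0 : ℝ) < n := by positivity
  rw [div_le_iff₀ hn'] at h1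
  rw [le_sub_comm, div_le_iff₀ hn'] at h2
  rw [cutoff, Real.smoothTransition.one_of_one_le (by linarith),
    Real.smoothTransition.one_of_one_le (by linarith), one_mul]

theorem tendsto_cutoff {z : ℝ} (hz : z ∈ Ioo (0 : ℝ) 1) :
    Tendsto (fun n => cutoff n z) atTop (𝓝 1) := by
  have ht : Tendsto (fun n : ℕ => (2 / n : ℝ)) atTop (𝓝 0) := tendsto_const_div_atTop_nhds_zero_nat 2
  refine tendsto_const_nhds.congr' ?_
  filter_upwards [ht.eventually (gt_mem_nhds hz.1), ht.eventually (gt_mem_nhds (sub_pos.2 hz.2)),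
    eventually_ne_atTop 0] with n h1 h2 h3
  exact (cutoff_eq_one h3 h1.le (by linarith)).symm

/-- The derivative of the fixed transition function vanishes outside `[0, 1]`, hence is bounded, and
scaling contributes the factor `n`. This growth is later balanced by the measure `4 / n` of the
region where the cutoff is not locally constant. -/
theorem exists_abs_deriv_cutoff_le :
    ∃ M : ℝ, 0 < M ∧ ∀ (n : ℕ) (z : ℝ), |deriv (cutoff n) z| ≤ M * n := by
  have hcd : ContDiff ℝ ∞ Real.smoothTransition := Real.smoothTransition.contDiff
  have hdc : Continuous (deriv Real.smoothTransition) :=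
    (contDiff_infty_iff_deriv.1 hcd).2.continuous
  obtain ⟨M, hM⟩ := isCompact_Icc.exists_bound_of_continuousOn (s := Icc (0 : ℝ) 1) hdc.continuousOn
  have hM' : ∀ y, |deriv Real.smoothTransition y| ≤ |M| := fun y => by
    by_cases hy : y ∈ Icc (0 : ℝ) 1
    · exact (hM y hy).trans (le_abs_self M)
    · rw [mem_Icc, not_and_or, not_le, not_le] at hy
      have : deriv Real.smoothTransition y = 0 := by
        rcases hy with hy | hy
        · have : Real.smoothTransition =ᶠ[𝓝 y] fun _ => 0 :=
            (gt_mem_nhds hy).mono fun t ht => Real.smoothTransition.zero_of_nonpos ht.le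
          rw [this.deriv_eq]; simp
        · have : Real.smoothTransition =ᶠ[𝓝 y] fun _ => 1 :=
            (lt_mem_nhds hy).mono fun t ht => Real.smoothTransition.one_of_one_le ht.le
          rw [this.deriv_eq]; simp
      rw [this, abs_zero]; positivity
  refine ⟨2 * |M| + 1, by positivity, fun n z => ?_⟩
  have hd : ∀ y, HasDerivAt Real.smoothTransition (deriv Real.smoothTransition y) y := fun y =>
    (hcd.differentiable (by simp) y).hasDerivAt
  have d1 : HasDerivAt (fun z : ℝ => Real.smoothTransition (n * z - 1))
      (deriv Real.smoothTransition (n * z - 1) * n) z := by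
    refine (hd _).comp z ?_
    simpa using ((hasDerivAt_id z).const_mul (n : ℝ)).sub_const 1
  have d2 : HasDerivAt (fun z : ℝ => Real.smoothTransition (n * (1 - z) - 1))
      (deriv Real.smoothTransition (n * (1 - z) - 1) * (-n)) z := by
    refine (hd _).comp z ?_
    simpa using (((hasDerivAt_id z).const_sub 1).const_mul (n : ℝ)).sub_const 1
  have h := (d1.mul d2).deriv
  rw [show deriv (cutoff n) z = _ from h]
  have b1 := hM' (n * z - 1)
  have b2 := hM' (n * (1 - z) - 1)
  set A := deriv Real.smoothTransition (n * z - 1)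
  set B := deriv Real.smoothTransition (n * (1 - z) - 1)
  have t1 : |Real.smoothTransition (n * (1 - z) - 1)| ≤ 1 := by
    rw [abs_of_nonneg (Real.smoothTransition.nonneg _)]; exact Real.smoothTransition.le_one _
  have t2 : |Real.smoothTransition (n * z - 1)| ≤ 1 := by
    rw [abs_of_nonneg (Real.smoothTransition.nonneg _)]; exact Real.smoothTransition.le_one _
  have hn : (0 : ℝ) ≤ n := n.cast_nonneg
  calc _ ≤ |A * n * Real.smoothTransition (n * (1 - z) - 1)| +
        |Real.smoothTransition (n * z - 1) * (B * -n)| := abs_add_le _ _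
    _ = |A| * n * |Real.smoothTransition (n * (1 - z) - 1)| +
        |Real.smoothTransition (n * z - 1)| * (|B| * n) := by
      simp only [abs_mul, abs_neg, Nat.abs_cast]
    _ ≤ |M| * n * 1 + 1 * (|M| * n) := by gcongr
    _ ≤ (2 * |M| + 1) * n := by nlinarith

theorem deriv_cutoff_eq_zero {n : ℕ} (hn : n ≠ 0) {z : ℝ} (h1 : 2 / n < z) (h2 : z < 1 - 2 / n) :
    deriv (cutoff n) z = 0 := by
  have : cutoff n =ᶠ[𝓝 z] fun _ => 1 := by
    filter_upwards [lt_mem_nhds h1, gt_mem_nhds h2] with t ht1 ht2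
    exact cutoff_eq_one hn ht1.le ht2.le
  rw [this.deriv_eq]; simp

theorem eventually_nhdsWithin_inf_ae {S : Set ℝ} {x₀ : ℝ} (hS : MeasurableSet S) {p : ℝ → Prop}
    (h : ∀ᵐ x ∂volume.restrict S, p x) : ∀ᶠ x in 𝓝[S] x₀ ⊓ ae volume, p x := by
  rw [ae_restrict_iff' hS] at h
  exact Filter.eventually_inf.2 ⟨S, self_mem_nhdsWithin, _, h, fun x hx => hx.2 hx.1⟩

/-- If `F` has weak derivative `G` on `(0,1)` and the same boundary value at both ends, then `G` has
mean zero. -/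
theorem integral_weakDeriv_eq_zero {F G : ℝ → ℂ} (hF : Integrable F unitMeasure)
    (hG : Integrable G unitMeasure) {T : ℂ}
    (h0 : Tendsto F (𝓝[Ioo 0 1] 0 ⊓ ae volume) (𝓝 T))
    (h1 : Tendsto F (𝓝[Ioo 0 1] 1 ⊓ ae volume) (𝓝 T))
    (hw : ∀ θ : ℝ → ℂ, IsBump (Ioo 0 1) θ →
      ∫ z, F z * deriv θ z ∂unitMeasure = -∫ z, G z * θ z ∂unitMeasure) :
    ∫ z, G z ∂unitMeasure = 0 := by
  have hlim : Tendsto (fun n : ℕ => ∫ z, G z * (cutoff n z : ℂ) ∂unitMeasure) atTop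
      (𝓝 (∫ z, G z ∂unitMeasure)) := by
    refine tendsto_integral_of_dominated_convergence (fun z => ‖G z‖) (fun n => ?_) hG.norm
      (fun n => ae_of_all _ fun z => ?_) ?_
    · exact hG.1.mul (Complex.continuous_ofReal.comp
        (contDiff_cutoff n).continuous).aestronglyMeasurable
    · rw [norm_mul, Complex.norm_real, Real.norm_of_nonneg (cutoff_nonneg n z)]
      exact mul_le_of_le_one_right (norm_nonneg _) (cutoff_le_one n z)
    · filter_upwards [ae_restrict_mem measurableSet_Ioo] with z hz
      have := ((Complex.continuous_ofReal.tendsto 1).comp (tendsto_cutoff hz)).const_mul (G z)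
      simpa using this
  refine tendsto_nhds_unique hlim ?_
  obtain ⟨M, hM, hMb⟩ := exists_abs_deriv_cutoff_le
  rw [Metric.tendsto_atTop]
  intro ε hε
  -- Chosen so that the final product `ε' * (M n) * (4 / n)` equals `ε / 2`.
  set ε' := ε / (8 * M) with hε'
  have hε'pos : 0 < ε' := by positivity
  obtain ⟨s₀, hs₀, t₀, ht₀, hst₀⟩ :=
    Filter.eventually_inf.1 (h0.eventually (Metric.closedBall_mem_nhds T hε'pos))
  obtain ⟨s₁, hs₁, t₁, ht₁, hst₁⟩ :=
    Filter.eventually_inf.1 (h1.eventually (Metric.closedBall_mem_nhds T hε'pos))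
  obtain ⟨δ₀, hδ₀, hδs₀⟩ := Metric.mem_nhdsWithin_iff.1 hs₀
  obtain ⟨δ₁, hδ₁, hδs₁⟩ := Metric.mem_nhdsWithin_iff.1 hs₁
  have ht : Tendsto (fun n : ℕ => (2 / n : ℝ)) atTop (𝓝 0) := tendsto_const_div_atTop_nhds_zero_nat 2
  obtain ⟨N, hN⟩ := eventually_atTop.1 ((ht.eventually (gt_mem_nhds hδ₀)).and
    ((ht.eventually (gt_mem_nhds hδ₁)).and (eventually_ne_atTop 0)))
  refine ⟨N, fun n hn => ?_⟩
  obtain ⟨hn0, hn1, hnz⟩ := hN n hn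
  have hn' : (0 : ℝ) < n := by positivity
  have hb := isBump_cutoff hnz
  have hd : ∀ z, deriv (fun z => (cutoff n z : ℂ)) z = ((deriv (cutoff n) z : ℝ) : ℂ) := fun z =>
    (((contDiff_cutoff n).differentiable (by simp) z).hasDerivAt.ofReal_comp).deriv
  have hdcont : Continuous (deriv fun z => (cutoff n z : ℂ)) := hb.deriv.continuous
  -- The cutoff vanishes at both ends, so a constant may be subtracted from `F` for free. One
  -- constant `T` makes `F - T` small at both ends, which is where equality of the boundary values
  -- enters.
  have hTi : ∫ z, T * deriv (fun z => (cutoff n z : ℂ)) z ∂unitMeasure = 0 := by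
    rw [integral_const_mul, ← integral_Ioc_eq_integral_Ioo,
      ← intervalIntegral.integral_of_le zero_le_one,
      intervalIntegral.integral_deriv_eq_sub (fun x _ => hb.differentiable x)
        (hdcont.intervalIntegrable 0 1)]
    have e0 : cutoff n 0 = 0 := by
      by_contra h
      have := (support_cutoff hnz h).1
      have : (0 : ℝ) < 1 / n := by positivity
      linarith
    have e1 : cutoff n 1 = 0 := by
      by_contra h
      have := (support_cutoff hnz h).2
      have : (0 : ℝ) < 1 / n := by positivity
      linarith
    simp [e0, e1]
  have hdb : ∀ z, ‖deriv (fun z => (cutoff n z : ℂ)) z‖ ≤ M * n := fun z => by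
    rw [hd, Complex.norm_real]; exact hMb n z
  have iF : Integrable (fun z => F z * deriv (fun z => (cutoff n z : ℂ)) z) unitMeasure :=
    hF.mul_bdd (c := M * n) hdcont.aestronglyMeasurable (ae_of_all _ hdb)
  have iT : Integrable (fun z => T * deriv (fun z => (cutoff n z : ℂ)) z) unitMeasure :=
    (integrable_const T).mul_bdd (c := M * n) hdcont.aestronglyMeasurable (ae_of_all _ hdb)
  have hGF : ∫ z, G z * (cutoff n z : ℂ) ∂unitMeasure =
      -∫ z, (F z - T) * deriv (fun z => (cutoff n z : ℂ)) z ∂unitMeasure := by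
    simp only [sub_mul]
    rw [integral_sub iF iT, hTi, hw _ hb]; simp
  rw [hGF, dist_zero_right, norm_neg]
  set S : Set ℝ := Ioo 0 1 ∩ (Icc 0 (2 / n) ∪ Icc (1 - 2 / n) 1) with hS
  have hset : ∫ z, (F z - T) * deriv (fun z => (cutoff n z : ℂ)) z ∂unitMeasure =
      ∫ z in S, (F z - T) * deriv (fun z => (cutoff n z : ℂ)) z := by
    refine setIntegral_eq_of_subset_of_forall_sdiff_eq_zero measurableSet_Ioo inter_subset_left
      fun z hz => ?_
    have hz1 := hz.1
    have hz2 : ¬ (z ∈ Icc (0 : ℝ) (2 / n) ∪ Icc (1 - 2 / n : ℝ) 1) := fun h => hz.2 ⟨hz1, h⟩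
    have a1 : 2 / n < z := by
      by_contra h; exact hz2 (Or.inl ⟨hz1.1.le, not_lt.1 h⟩)
    have a2 : z < 1 - 2 / n := by
      by_contra h; exact hz2 (Or.inr ⟨not_lt.1 h, hz1.2.le⟩)
    rw [hd, deriv_cutoff_eq_zero hnz a1 a2]; simp
  have hvol : volume S ≤ ENNReal.ofReal (4 / n) := by
    calc volume S ≤ volume (Icc (0 : ℝ) (2 / n) ∪ Icc (1 - 2 / n : ℝ) 1) :=
          measure_mono inter_subset_right
      _ ≤ volume (Icc (0 : ℝ) (2 / n)) + volume (Icc (1 - 2 / n : ℝ) 1) := measure_union_le _ _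
      _ = ENNReal.ofReal (4 / n) := by
        rw [Real.volume_Icc, Real.volume_Icc, ← ENNReal.ofReal_add (by simp; positivity)
          (by simp; positivity)]
        congr 1; ring
  have hvol' : volume.real S ≤ 4 / n :=
    ENNReal.toReal_le_of_le_ofReal (by positivity) hvol
  have hbound : ∀ᵐ z ∂volume, z ∈ S →
      ‖(F z - T) * deriv (fun z => (cutoff n z : ℂ)) z‖ ≤ ε' * (M * n) := by
    filter_upwards [ht₀, ht₁] with z hz₀ hz₁ hzS
    rw [norm_mul]
    refine mul_le_mul ?_ (hdb z) (norm_nonneg _) hε'pos.le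
    rw [← dist_eq_norm]
    rcases hzS.2 with h | h
    · refine hst₀ z ⟨hδs₀ ⟨?_, hzS.1⟩, hz₀⟩
      rw [Metric.mem_ball, Real.dist_eq, sub_zero, abs_of_nonneg h.1]
      exact h.2.trans_lt hn0
    · refine hst₁ z ⟨hδs₁ ⟨?_, hzS.1⟩, hz₁⟩
      rw [Metric.mem_ball, Real.dist_eq, abs_of_nonpos (by linarith [h.2])]
      linarith [h.1]
  rw [hset]
  calc _ ≤ ε' * (M * n) * volume.real S := norm_setIntegral_le_of_norm_le_const_ae'
          (hvol.trans_lt ENNReal.ofReal_lt_top) hbound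
    _ ≤ ε' * (M * n) * (4 / n) := by gcongr
    _ = ε / 2 := by rw [hε']; field_simp; norm_num
    _ < ε := by linarith

/-! ### Functions on the strip -/

theorem restrict_strip (I : Set ℝ) :
    volume.restrict (strip I) = (volume.restrict I).prod unitMeasure := by
  rw [strip, Measure.volume_eq_prod, Measure.prod_restrict]

theorem ae_memLp_slice {α β : Type*} [MeasurableSpace α] [MeasurableSpace β] {μ : Measure α}
    {ν : Measure β} [SFinite ν] {F : α × β → ℂ} (h : MemLp F 2 (μ.prod ν)) :
    ∀ᵐ x ∂μ, MemLp (fun y => F (x, y)) 2 ν := by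
  have hm : AEMeasurable (fun p => ‖F p‖ₑ ^ 2) (μ.prod ν) := h.1.enorm.pow_const 2
  have hfin := lintegral_enorm_sq_lt_top h
  rw [lintegral_prod _ hm] at hfin
  filter_upwards [h.1.prodMk_left, ae_lt_top' hm.lintegral_prod_right' hfin.ne] with x h1 h2
  exact memLp_two_of_lintegral_lt_top h1 h2

theorem ae_memLp_slice_swap {α β : Type*} [MeasurableSpace α] [MeasurableSpace β] {μ : Measure α}
    {ν : Measure β} [SFinite μ] [SFinite ν] {F : α × β → ℂ} (h : MemLp F 2 (μ.prod ν)) :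
    ∀ᵐ y ∂ν, MemLp (fun x => F (x, y)) 2 μ :=
  ae_memLp_slice (F := F ∘ Prod.swap) (h.comp_measurePreserving Measure.measurePreserving_swap)

theorem memLp_mul_prod {α β : Type*} [MeasurableSpace α] [MeasurableSpace β] {μ : Measure α}
    {ν : Measure β} [SFinite ν] {f : α → ℂ} {g : β → ℂ} (hf : MemLp f 2 μ) (hg : MemLp g 2 ν) :
    MemLp (fun p : α × β => f p.1 * g p.2) 2 (μ.prod ν) := by
  refine memLp_two_of_lintegral_lt_top (hf.1.comp_fst.mul hg.1.comp_snd) ?_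
  simp only [enorm_mul, mul_pow]
  rw [lintegral_prod_mul (hf.1.enorm.pow_const 2) (hg.1.enorm.pow_const 2)]
  exact ENNReal.mul_lt_top (lintegral_enorm_sq_lt_top hf) (lintegral_enorm_sq_lt_top hg)

theorem enorm_integral_mul_le {α : Type*} [MeasurableSpace α] {μ : Measure α} {f g : α → ℂ}
    (hf : AEStronglyMeasurable f μ) (hg : AEStronglyMeasurable g μ) :
    ‖∫ x, f x * g x ∂μ‖ₑ ≤ eLpNorm f 2 μ * eLpNorm g 2 μ := by
  refine (enorm_integral_le_lintegral_enorm _).trans ?_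
  have h : eLpNorm (f • g) 1 μ ≤ eLpNorm f 2 μ * eLpNorm g 2 μ := eLpNorm_smul_le_mul_eLpNorm hg hf
  rw [eLpNorm_one_eq_lintegral_enorm] at h
  exact h

/-- The `k`-th Fourier coefficient in `z` of a function on the strip. -/
def coefFun (F : ℝ × ℝ → ℂ) (k : ℤ) (x : ℝ) : ℂ := fourierCoef (fun z => F (x, z)) k

/-- A single coefficient is dominated by the full Parseval sum on almost every slice; Tonelli then
integrates in `x`. -/
theorem memLp_coefFun {I : Set ℝ} {F : ℝ × ℝ → ℂ} (h : MemLp F 2 (volume.restrict (strip I)))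
    (k : ℤ) : MemLp (coefFun F k) 2 (volume.restrict I) := by
  rw [restrict_strip] at h
  have hm : AEStronglyMeasurable (coefFun F k) (volume.restrict I) := by
    have : coefFun F k = fun x => ∫ z, F (x, z) * expMode (-k) z ∂unitMeasure :=
      funext fun x => fourierCoef_eq _ k
    rw [this]
    exact AEStronglyMeasurable.integral_prod_right' (f := fun p => F p * expMode (-k) p.2)
      (h.1.mul (continuous_expMode (-k)).aestronglyMeasurable.comp_snd)
  refine memLp_two_of_lintegral_lt_top hm (lt_of_le_of_lt ?_ (lintegral_enorm_sq_lt_top h))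
  rw [lintegral_prod _ (h.1.enorm.pow_const 2)]
  refine lintegral_mono_ae ?_
  filter_upwards [ae_memLp_slice h] with x hx
  rw [lintegral_enorm_sq hx]
  exact ENNReal.le_tsum (f := fun k => ‖fourierCoef (fun z => F (x, z)) k‖ₑ ^ 2) k

theorem IsBump.memLp {I : Set ℝ} {χ : ℝ → ℂ} (h : IsBump I χ) (μ : Measure ℝ)
    [IsFiniteMeasureOnCompacts μ] : MemLp χ 2 μ :=
  h.continuous.memLp_of_hasCompactSupport h.compact

theorem integrable_strip_mul {I : Set ℝ} {F : ℝ × ℝ → ℂ} {χ θ : ℝ → ℂ}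
    (h : MemLp F 2 (volume.restrict (strip I))) (hχ : MemLp χ 2 (volume.restrict I))
    (hθ : MemLp θ 2 unitMeasure) :
    Integrable (fun p => F p * (χ p.1 * θ p.2)) (volume.restrict (strip I)) := by
  rw [restrict_strip] at h ⊢
  exact h.integrable_mul (memLp_mul_prod hχ hθ)

theorem integral_strip_expMode {I : Set ℝ} {F : ℝ × ℝ → ℂ} {χ : ℝ → ℂ}
    (h : MemLp F 2 (volume.restrict (strip I))) (hχ : MemLp χ 2 (volume.restrict I)) (k : ℤ) :
    ∫ p in strip I, F p * (χ p.1 * expMode (-k) p.2) = ∫ x in I, coefFun F k x * χ x := by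
  have hi := integrable_strip_mul h hχ (memLp_expMode (-k))
  rw [restrict_strip] at hi ⊢
  rw [integral_prod _ hi]
  refine integral_congr_ae (ae_of_all _ fun x => ?_)
  simp only [coefFun, fourierCoef_eq]
  rw [← integral_mul_const]
  refine integral_congr_ae (ae_of_all _ fun z => ?_)
  simp only; ring

theorem integral_strip_swap {I : Set ℝ} {F : ℝ × ℝ → ℂ} {χ θ : ℝ → ℂ}
    (h : MemLp F 2 (volume.restrict (strip I))) (hχ : MemLp χ 2 (volume.restrict I))
    (hθ : MemLp θ 2 unitMeasure) :
    ∫ p in strip I, F p * (χ p.1 * θ p.2) =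
      ∫ z, (∫ x in I, F (x, z) * χ x) * θ z ∂unitMeasure := by
  have hi := integrable_strip_mul h hχ hθ
  rw [restrict_strip] at hi ⊢
  rw [integral_prod_symm _ hi]
  refine integral_congr_ae (ae_of_all _ fun z => ?_)
  simp only
  rw [← integral_mul_const]
  refine integral_congr_ae (ae_of_all _ fun x => ?_)
  simp only; ring

theorem integrable_strip_integral {I : Set ℝ} {F : ℝ × ℝ → ℂ} {χ : ℝ → ℂ}
    (h : MemLp F 2 (volume.restrict (strip I))) (hχ : MemLp χ 2 (volume.restrict I)) :
    Integrable (fun z => ∫ x in I, F (x, z) * χ x) unitMeasure := by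
  have hi := integrable_strip_mul h hχ (memLp_expMode 0)
  rw [restrict_strip] at hi
  simpa using hi.integral_prod_right

theorem fderiv_mul_prod {χ θ : ℝ → ℂ} (hχ : Differentiable ℝ χ) (hθ : Differentiable ℝ θ)
    (p : ℝ × ℝ) (v : ℝ × ℝ) : fderiv ℝ (fun p : ℝ × ℝ => χ p.1 * θ p.2) p v =
      v.1 * (deriv χ p.1 * θ p.2) + v.2 * (χ p.1 * deriv θ p.2) := by
  have h1 : HasFDerivAt (fun p : ℝ × ℝ => χ p.1) _ p :=
    (hχ p.1).hasDerivAt.hasFDerivAt.comp p hasFDerivAt_fst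
  have h2 : HasFDerivAt (fun p : ℝ × ℝ => θ p.2) _ p :=
    (hθ p.2).hasDerivAt.hasFDerivAt.comp p hasFDerivAt_snd
  have h := (h1.mul h2).fderiv
  rw [show fderiv ℝ (fun p : ℝ × ℝ => χ p.1 * θ p.2) p = _ from h]
  simp
  ring

theorem tsupport_mul_prod_subset (χ θ : ℝ → ℂ) :
    tsupport (fun p : ℝ × ℝ => χ p.1 * θ p.2) ⊆ tsupport χ ×ˢ tsupport θ := by
  refine closure_minimal (fun p hp => ⟨subset_tsupport _ ?_, subset_tsupport _ ?_⟩)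
    ((isClosed_tsupport _).prod (isClosed_tsupport _))
  · exact left_ne_zero_of_mul hp
  · exact right_ne_zero_of_mul hp

theorem HasWeakDeriv.mul_prod {I : Set ℝ} {v : ℝ × ℝ} {u u' : ℝ × ℝ → ℂ}
    (h : HasWeakDeriv (strip I) v u u') {χ θ : ℝ → ℂ} (hχ : IsBump I χ) (hθ : IsBump (Ioo 0 1) θ) :
    ∫ p in strip I, u p * (v.1 * (deriv χ p.1 * θ p.2) + v.2 * (χ p.1 * deriv θ p.2)) =
      -∫ p in strip I, u' p * (χ p.1 * θ p.2) := by
  have hsub := tsupport_mul_prod_subset χ θ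
  have := h (fun p : ℝ × ℝ => χ p.1 * θ p.2)
    ((hχ.contDiff.comp contDiff_fst).mul (hθ.contDiff.comp contDiff_snd))
    (IsCompact.of_isClosed_subset (hχ.compact.prod hθ.compact) (isClosed_tsupport _) hsub)
    (hsub.trans (prod_mono hχ.subset hθ.subset))
  simpa only [fderiv_mul_prod hχ.differentiable hθ.differentiable] using this

/-! ### Fourier modes of weak solutions -/

/-- Exponentials are not compactly supported in `(0, 1)`, so they are inadmissible in the definition
of weak derivatives. The cutoff makes them admissible and disappears in the limit. -/
theorem tendsto_integral_cutoff {I : Set ℝ} {F : ℝ × ℝ → ℂ} {χ : ℝ → ℂ}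
    (h : MemLp F 2 (volume.restrict (strip I))) (hχ : MemLp χ 2 (volume.restrict I)) (k : ℤ) :
    Tendsto (fun n : ℕ => ∫ p in strip I, F p * (χ p.1 * (expMode (-k) p.2 * (cutoff n p.2 : ℂ))))
      atTop (𝓝 (∫ x in I, coefFun F k x * χ x)) := by
  rw [← integral_strip_expMode h hχ k]
  have hi := integrable_strip_mul h hχ (memLp_expMode (-k))
  have hcut : ∀ n, Continuous fun p : ℝ × ℝ => (cutoff n p.2 : ℂ) := fun n =>
    Complex.continuous_ofReal.comp ((contDiff_cutoff n).continuous.comp continuous_snd)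
  have e : ∀ (n : ℕ) (p : ℝ × ℝ), F p * (χ p.1 * (expMode (-k) p.2 * (cutoff n p.2 : ℂ))) =
      F p * (χ p.1 * expMode (-k) p.2) * (cutoff n p.2 : ℂ) := fun n p => by ring
  simp only [e]
  refine tendsto_integral_of_dominated_convergence
    (fun p => ‖F p * (χ p.1 * expMode (-k) p.2)‖) (fun n => ?_) hi.norm
    (fun n => ae_of_all _ fun p => ?_) ?_
  · exact hi.1.mul (hcut n).aestronglyMeasurable
  · rw [norm_mul, Complex.norm_real, Real.norm_of_nonneg (cutoff_nonneg n p.2)]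
    exact mul_le_of_le_one_right (norm_nonneg _) (cutoff_le_one n p.2)
  · have hae : ∀ᵐ p ∂volume.restrict (strip I), p.2 ∈ Ioo (0 : ℝ) 1 := by
      rw [restrict_strip]
      exact Measure.quasiMeasurePreserving_snd.ae (ae_restrict_mem measurableSet_Ioo)
    filter_upwards [hae] with p hp
    have := ((Complex.continuous_ofReal.tendsto 1).comp (tendsto_cutoff hp)).const_mul
      (F p * (χ p.1 * expMode (-k) p.2))
    simpa using this

/-- The Fourier coefficients of the weak `x`-derivative are the weak derivatives of the
Fourier coefficients. -/
theorem integral_coefFun_mul_deriv {I : Set ℝ} (w : H1 (strip I)) (k : ℤ) {χ : ℝ → ℂ}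
    (hχ : IsBump I χ) :
    ∫ x in I, coefFun w.val k x * deriv χ x = -∫ x in I, coefFun w.dx k x * χ x := by
  have t1 := tendsto_integral_cutoff w.memLp_val (hχ.deriv.memLp (volume.restrict I)) k
  have t2 := (tendsto_integral_cutoff w.memLp_dx (hχ.memLp (volume.restrict I)) k).neg
  refine tendsto_nhds_unique t1 (t2.congr' ?_)
  filter_upwards [eventually_ne_atTop 0] with n hn
  -- The `x`-derivative does not fall on the cutoff, so no boundary condition in `z` is needed here.
  have := HasWeakDeriv.mul_prod w.weak_dx hχ ((isBump_cutoff hn).mul_left (contDiff_expMode (-k)))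
  rw [← this]
  simp

/-- Cauchy–Schwarz in `x`. It turns the `L²` trace into a boundary value of the scalar function `z ↦
∫ u(x, z) χ(x) dx`. -/
theorem tendsto_integral_of_hasTraceZ {I : Set ℝ} {u : ℝ × ℝ → ℂ} {t χ : ℝ → ℂ} {z₀ : ℝ}
    (hu : MemLp u 2 (volume.restrict (strip I))) (hχ : MemLp χ 2 (volume.restrict I))
    (ht : HasTraceZ I z₀ u t) :
    Tendsto (fun z => ∫ x in I, u (x, z) * χ x) (𝓝[Ioo 0 1] z₀ ⊓ ae volume)
      (𝓝 (∫ x in I, t x * χ x)) := by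
  rw [tendsto_iff_edist_tendsto_0]
  have hlim : Tendsto (fun z => eLpNorm (fun x => u (x, z) - t x) 2 (volume.restrict I) *
      eLpNorm χ 2 (volume.restrict I)) (𝓝[Ioo 0 1] z₀ ⊓ ae volume) (𝓝 0) := by
    simpa using ENNReal.Tendsto.mul_const ht.2 (Or.inr hχ.2.ne)
  refine tendsto_of_tendsto_of_tendsto_of_le_of_le' tendsto_const_nhds hlim
    (Eventually.of_forall fun _ => zero_le) ?_
  rw [restrict_strip] at hu
  filter_upwards [eventually_nhdsWithin_inf_ae measurableSet_Ioo (ae_memLp_slice_swap hu)] with z hz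
  have h1 : Integrable (fun x => u (x, z) * χ x) (volume.restrict I) := hz.integrable_mul hχ
  have h2 : Integrable (fun x => t x * χ x) (volume.restrict I) := ht.1.integrable_mul hχ
  rw [edist_eq_enorm_sub, ← integral_sub h1 h2]
  simp only [← sub_mul]
  exact enorm_integral_mul_le (hz.1.sub ht.1.1) hχ.1

/-- For periodic functions the Fourier coefficients of the weak `z`-derivative are `2πik` times the
Fourier coefficients. -/
theorem integral_coefFun_dz {I : Set ℝ} (w : H1 (strip I)) {t : ℝ → ℂ}
    (h0 : HasTraceZ I 0 w.val t) (h1 : HasTraceZ I 1 w.val t) (k : ℤ) {χ : ℝ → ℂ}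
    (hχ : IsBump I χ) :
    ∫ x in I, coefFun w.dz k x * χ x =
      2 * Real.pi * Complex.I * k * ∫ x in I, coefFun w.val k x * χ x := by
  have hχm := hχ.memLp (volume.restrict I)
  set F : ℝ → ℂ := fun z => ∫ x in I, w.val (x, z) * χ x with hF
  set G : ℝ → ℂ := fun z => ∫ x in I, w.dz (x, z) * χ x with hG
  have iF : Integrable F unitMeasure := integrable_strip_integral w.memLp_val hχm
  have iG : Integrable G unitMeasure := integrable_strip_integral w.memLp_dz hχm
  set a : ℂ := 2 * Real.pi * Complex.I * k with ha
  have iFe := integrable_mul_expMode iF (-k)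
  have iGe := integrable_mul_expMode iG (-k)
  have hder : ∀ z, HasDerivAt (expMode (-k)) (-a * expMode (-k) z) z := fun z => by
    convert hasDerivAt_expMode (-k) z using 1
    rw [ha]; push_cast; ring
  have hmem : ∀ θ : ℝ → ℂ, IsBump (Ioo 0 1) θ → MemLp θ 2 unitMeasure := fun θ hθ => hθ.memLp _
  have tend : ∀ z₀ : ℝ, expMode (-k) z₀ = 1 → HasTraceZ I z₀ w.val t →
      Tendsto (fun z => F z * expMode (-k) z) (𝓝[Ioo 0 1] z₀ ⊓ ae volume)
        (𝓝 (∫ x in I, t x * χ x)) := fun z₀ hz₀ ht => by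
    have t1 := tendsto_integral_of_hasTraceZ w.memLp_val hχm ht
    have t2 : Tendsto (expMode (-k)) (𝓝[Ioo 0 1] z₀ ⊓ ae volume) (𝓝 1) := by
      rw [← hz₀]
      exact ((continuous_expMode (-k)).tendsto z₀).mono_left (inf_le_left.trans nhdsWithin_le_nhds)
    simpa using t1.mul t2
  -- The function `F exp(-2πikz)` has weak derivative `(G - aF) exp(-2πikz)`. The exponential equals
  -- one at both ends, so the boundary values coincide, and the vanishing mean is the claimed
  -- relation.
  have key := integral_weakDeriv_eq_zero (F := fun z => F z * expMode (-k) z)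
    (G := fun z => G z * expMode (-k) z - a * (F z * expMode (-k) z)) iFe (iGe.sub (iFe.const_mul a))
    (tend 0 (expMode_zero _) h0) (tend 1 (expMode_one _) h1) fun θ hθ => by
      have hb := hθ.mul_left (contDiff_expMode (-k))
      have hd : ∀ z, deriv (fun z => expMode (-k) z * θ z) z =
          -a * expMode (-k) z * θ z + expMode (-k) z * deriv θ z := fun z =>
        ((hder z).mul (hθ.differentiable z).hasDerivAt).deriv
      have hw := HasWeakDeriv.mul_prod w.weak_dz hχ hb
      simp only [Complex.ofReal_zero, zero_mul, zero_add, Complex.ofReal_one, one_mul] at hw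
      rw [integral_strip_swap w.memLp_val hχm (hmem _ hb.deriv),
        integral_strip_swap w.memLp_dz hχm (hmem _ hb)] at hw
      change ∫ z, F z * _ ∂unitMeasure = -∫ z, G z * _ ∂unitMeasure at hw
      have bdd : ∀ {f θ' : ℝ → ℂ}, IsBump (Ioo 0 1) θ' → Integrable f unitMeasure →
          Integrable (fun z => f z * θ' z) unitMeasure := fun hθ' hf => by
        exact integrable_mul_of_hasCompactSupport hf.locallyIntegrable hθ'.continuous hθ'.compact
      have e1 : ∫ z, F z * expMode (-k) z * deriv θ z ∂unitMeasure =
          (∫ z, F z * deriv (fun z => expMode (-k) z * θ z) z ∂unitMeasure) +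
            ∫ z, a * (F z * expMode (-k) z) * θ z ∂unitMeasure := by
        rw [← integral_add (bdd hb.deriv iF) (bdd hθ (iFe.const_mul a))]
        refine integral_congr_ae (ae_of_all _ fun z => ?_)
        simp only [hd]; ring
      have e2 : ∫ z, (G z * expMode (-k) z - a * (F z * expMode (-k) z)) * θ z ∂unitMeasure =
          (∫ z, G z * (expMode (-k) z * θ z) ∂unitMeasure) -
            ∫ z, a * (F z * expMode (-k) z) * θ z ∂unitMeasure := by
        rw [← integral_sub (bdd hb iG) (bdd hθ (iFe.const_mul a))]
        refine integral_congr_ae (ae_of_all _ fun z => ?_)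
        simp only; ring
      rw [e1, e2, hw]; ring
  rw [integral_sub iGe (iFe.const_mul a), integral_const_mul, sub_eq_zero] at key
  rw [← integral_strip_expMode w.memLp_dz hχm, ← integral_strip_expMode w.memLp_val hχm,
    integral_strip_swap w.memLp_dz hχm (memLp_expMode _),
    integral_strip_swap w.memLp_val hχm (memLp_expMode _)]
  exact key

theorem isTest_mul_expMode {I : Set ℝ} {χ : ℝ → ℂ} (hχ : IsBump I χ) (k : ℤ) :
    IsTest I fun p => χ p.1 * expMode k p.2 :=
  ⟨(hχ.contDiff.comp contDiff_fst).mul ((contDiff_expMode k).comp contDiff_snd),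
    fun x z => by simp only [expMode_add_one], tsupport χ, hχ.compact, hχ.subset,
    fun x z hx => by simp only [image_eq_zero_of_notMem_tsupport hx, zero_mul]⟩

theorem integral_neg_add_mul_add_mul {α : Type*} [MeasurableSpace α] {μ : Measure α}
    {f g h : α → ℂ} (hf : Integrable f μ) (hg : Integrable g μ) (hh : Integrable h μ) (a b : ℂ) :
    ∫ x, (-f x + a * g x + b * h x) ∂μ =
      -(∫ x, f x ∂μ) + a * (∫ x, g x ∂μ) + b * ∫ x, h x ∂μ := by
  rw [← integral_const_mul, ← integral_const_mul, ← integral_neg,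
    ← integral_add hf.fun_neg (hg.const_mul a),
    ← integral_add (hf.fun_neg.fun_add (hg.const_mul a)) (hh.const_mul b)]

/-- The Fourier coefficients of a solution satisfy `w_k'' + β_k w_k = 0` weakly. -/
theorem IsExteriorSolution.integral_coefFun_dx {I : Set ℝ} {x₀ κ : ℝ} {γ : ℂ} {g : ℝ → ℂ}
    {w : H1 (strip I)} (h : IsExteriorSolution I x₀ κ γ g w) (k : ℤ) {χ : ℝ → ℂ}
    (hχ : IsBump I χ) :
    ∫ x in I, coefFun w.dx k x * deriv χ x = beta κ γ k * ∫ x in I, coefFun w.val k x * χ x := by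
  obtain ⟨t, h0, h1⟩ := h.periodic
  have hz := integral_coefFun_dz w h0 h1 k hχ
  have heq := h.equation _ (isTest_mul_expMode hχ (-k))
  have hχm := hχ.memLp (volume.restrict I)
  have hχ'm := hχ.deriv.memLp (volume.restrict I)
  have i1 := integrable_strip_mul w.memLp_dx hχ'm (memLp_expMode (-k))
  have i2 := integrable_strip_mul w.memLp_dz hχm (memLp_expMode (-k))
  have i3 := integrable_strip_mul w.memLp_val hχm (memLp_expMode (-k))
  have hdiff : Differentiable ℝ (expMode (-k)) := fun z => (hasDerivAt_expMode (-k) z).differentiableAt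
  have hderiv : ∀ z, deriv (expMode (-k)) z = -(2 * Real.pi * Complex.I * k) * expMode (-k) z :=
    fun z => by rw [(hasDerivAt_expMode (-k) z).deriv]; push_cast; ring
  simp only [fderiv_mul_prod hχ.differentiable hdiff, hderiv] at heq
  have e : ∫ p in strip I, (-(w.dx p * (deriv χ p.1 * expMode (-k) p.2)) +
      (2 * Real.pi * Complex.I * k + 2 * γ) * (w.dz p * (χ p.1 * expMode (-k) p.2)) +
      (γ ^ 2 + (κ : ℂ) ^ 2) * (w.val p * (χ p.1 * expMode (-k) p.2))) = 0 := by
    rw [← heq]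
    refine integral_congr_ae (ae_of_all _ fun p => ?_)
    simp only [Complex.ofReal_zero, Complex.ofReal_one]
    ring
  rw [integral_neg_add_mul_add_mul i1 i2 i3, integral_strip_expMode w.memLp_dx hχ'm, integral_strip_expMode w.memLp_dz hχm,
    integral_strip_expMode w.memLp_val hχm, hz] at e
  rw [beta]
  -- After replacing the coefficients of `w_z` by `2πik w_k`, the zeroth order factor is `(2πik)² +
  -- 2γ(2πik) + γ² + κ² = β_k`.
  linear_combination -e

theorem tendsto_coefFun {I : Set ℝ} (hI : MeasurableSet I) {x₀ : ℝ} {u : ℝ × ℝ → ℂ} {g : ℝ → ℂ}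
    (hu : MemLp u 2 (volume.restrict (strip I))) (h : HasTraceX I x₀ u g) (k : ℤ) :
    Tendsto (coefFun u k) (𝓝[I] x₀ ⊓ ae volume) (𝓝 (fourierCoef g k)) := by
  rw [tendsto_iff_edist_tendsto_0]
  refine tendsto_of_tendsto_of_tendsto_of_le_of_le' tendsto_const_nhds h.2
    (Eventually.of_forall fun _ => zero_le) ?_
  rw [restrict_strip] at hu
  filter_upwards [eventually_nhdsWithin_inf_ae hI (ae_memLp_slice hu)] with x hx
  rw [edist_eq_enorm_sub, coefFun, ← fourierCoef_sub hx h.1]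
  exact enorm_fourierCoef_le (hx.sub h.1) k

theorem tendsto_modeX (σ x₀ : ℝ) (s : ℂ) : Tendsto (modeX σ x₀ s) (𝓝 x₀) (𝓝 1) := by
  have h := (contDiff_modeX σ x₀ s).continuous.tendsto x₀
  simpa [modeX] using h

/-- The Fourier coefficients of a solution of the exterior problem. -/
theorem IsExteriorSolution.coefFun_ae_eq {σ x₀ κ : ℝ} (hσ : σ = 1 ∨ σ = -1) {γ : ℂ}
    {g : ℝ → ℂ} {w : H1 (strip (halfLine σ x₀))}
    (h : IsExteriorSolution (halfLine σ x₀) x₀ κ γ g w) {k : ℤ} (hβ : (beta κ γ k).im ≠ 0) :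
    (∀ᵐ x ∂volume.restrict (halfLine σ x₀),
      coefFun w.val k x = fourierCoef g k * modeX σ x₀ (sCoef κ γ k) x) ∧
    ∀ᵐ x ∂volume.restrict (halfLine σ x₀), coefFun w.dx k x =
      σ * sCoef κ γ k * fourierCoef g k * modeX σ x₀ (sCoef κ γ k) x := by
  have hIm := measurableSet_halfLine σ x₀
  obtain ⟨c, hc1, hc2⟩ := exists_ae_eq_modeX hσ (sCoef_re_neg hβ) (memLp_coefFun w.memLp_val k)
    (memLp_coefFun w.memLp_dx k) (fun χ hχ => integral_coefFun_mul_deriv w k hχ)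
    (fun χ hχ => by rw [h.integral_coefFun_dx k hχ, sCoef_sq hβ]; ring)
  have := neBot_nhdsWithin_inf_ae (isOpen_halfLine σ x₀) (mem_closure_halfLine hσ x₀)
  have t1 := tendsto_coefFun hIm w.memLp_val h.dirichlet k
  -- The decaying exponential tends to one at `x₀`, so the constant is the limit of the coefficient,
  -- which the Dirichlet trace identifies as `g_k`.
  have t2 : Tendsto (coefFun w.val k) (𝓝[halfLine σ x₀] x₀ ⊓ ae volume) (𝓝 c) := by
    have t3 : Tendsto (fun x => c * modeX σ x₀ (sCoef κ γ k) x)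
        (𝓝[halfLine σ x₀] x₀ ⊓ ae volume) (𝓝 c) := by
      simpa using ((tendsto_modeX σ x₀ (sCoef κ γ k)).mono_left
        (inf_le_left.trans nhdsWithin_le_nhds)).const_mul c
    refine t3.congr' ?_
    filter_upwards [eventually_nhdsWithin_inf_ae hIm hc1] with x hx
    exact hx.symm
  rw [tendsto_nhds_unique t1 t2]
  exact ⟨hc1, hc2⟩

/-! ### Series of modes -/

/-- The mode `exp(s σ (x - x₀)) exp(2πikz)`. -/
def mode (σ x₀ : ℝ) (s : ℂ) (k : ℤ) (p : ℝ × ℝ) : ℂ := modeX σ x₀ s p.1 * expMode k p.2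

theorem continuous_mode (σ x₀ : ℝ) (s : ℂ) (k : ℤ) : Continuous (mode σ x₀ s k) :=
  ((contDiff_modeX σ x₀ s).continuous.comp continuous_fst).mul
    ((continuous_expMode k).comp continuous_snd)

theorem norm_mode (σ x₀ : ℝ) (s : ℂ) (k : ℤ) (p : ℝ × ℝ) :
    ‖mode σ x₀ s k p‖ = ‖modeX σ x₀ s p.1‖ := by
  rw [mode, norm_mul, norm_expMode, mul_one]

/-- The series `∑ b_k exp(s_k σ (x - x₀)) exp(2πikz)`. -/
def modeSeries (σ x₀ : ℝ) (s b : ℤ → ℂ) (p : ℝ × ℝ) : ℂ := ∑' k, b k * mode σ x₀ (s k) k p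

/-- The exponents `s_k` decay linearly with rate `c`. -/
def DecayRate (c : ℝ) (s : ℤ → ℂ) : Prop := 0 < c ∧ ∀ k, c * jap k ≤ -(s k).re

/-- The sequence `b` has at most quadratic growth. -/
def QuadGrowth (b : ℤ → ℂ) : Prop := ∃ M : ℝ, 0 ≤ M ∧ ∀ k, ‖b k‖ ≤ M * jap k ^ 2

theorem DecayRate.norm_modeX_le {c : ℝ} {s : ℤ → ℂ} (h : DecayRate c s) {σ x₀ δ x : ℝ}
    (hδ : 0 ≤ δ) (hx : δ ≤ σ * (x - x₀)) (k : ℤ) :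
    ‖modeX σ x₀ (s k) x‖ ≤ Real.exp (-(c * δ * jap k)) := by
  rw [norm_modeX]
  refine Real.exp_le_exp.2 ?_
  have h1 := h.2 k
  have h2 : 0 < c * jap k := mul_pos h.1 (jap_pos k)
  nlinarith [mul_le_mul h1 hx hδ (h2.le.trans h1)]

/-- At distance `δ` from `x₀` exponential decay beats polynomial growth. Quadratic growth is the
case needed, since second derivatives of a series with bounded coefficients occur. -/
theorem QuadGrowth.exists_bound {b : ℤ → ℂ} (hb : QuadGrowth b) {c : ℝ} {s : ℤ → ℂ}
    (h : DecayRate c s) (σ x₀ : ℝ) {δ : ℝ} (hδ : 0 < δ) :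
    ∃ B : ℤ → ℝ, Summable B ∧
      ∀ p : ℝ × ℝ, δ ≤ σ * (p.1 - x₀) → ∀ k, ‖b k * mode σ x₀ (s k) k p‖ ≤ B k := by
  obtain ⟨M, hM, hMb⟩ := hb
  refine ⟨fun k => M * (jap k ^ 2 * Real.exp (-(c * δ * jap k))),
    (summable_jap_sq_mul_exp (mul_pos h.1 hδ)).mul_left M, fun p hp k => ?_⟩
  beta_reduce
  rw [norm_mul, norm_mode, ← mul_assoc]
  exact mul_le_mul (hMb k) (h.norm_modeX_le hδ.le hp k) (norm_nonneg _)
    (mul_nonneg hM (sq_nonneg _))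

theorem hasSum_modeSeries {b : ℤ → ℂ} (hb : QuadGrowth b) {c : ℝ} {s : ℤ → ℂ}
    (h : DecayRate c s) {σ x₀ : ℝ} {p : ℝ × ℝ} (hp : p.1 ∈ halfLine σ x₀) :
    HasSum (fun k => b k * mode σ x₀ (s k) k p) (modeSeries σ x₀ s b p) := by
  obtain ⟨B, hB, hBb⟩ := hb.exists_bound h σ x₀ (δ := σ * (p.1 - x₀)) hp
  exact (Summable.of_norm_bounded hB (hBb p le_rfl)).hasSum

theorem ae_fst_mem_strip {I : Set ℝ} (hI : MeasurableSet I) :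
    ∀ᵐ p ∂volume.restrict (strip I), p.1 ∈ I := by
  filter_upwards [ae_restrict_mem (hI.prod measurableSet_Ioo)] with p hp using hp.1

theorem aestronglyMeasurable_of_hasSum {α : Type*} [MeasurableSpace α] {μ : Measure α}
    {f : ℤ → α → ℂ} {F : α → ℂ} (hf : ∀ k, AEStronglyMeasurable (f k) μ)
    (h : ∀ᵐ x ∂μ, HasSum (fun k => f k x) (F x)) : AEStronglyMeasurable F μ :=
  aestronglyMeasurable_of_tendsto_ae (u := atTop) (f := fun (t : Finset ℤ) x => ∑ k ∈ t, f k x)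
    (fun t => Finset.aestronglyMeasurable_fun_sum t fun k _ => hf k) h

theorem aestronglyMeasurable_modeSeries {b : ℤ → ℂ} (hb : QuadGrowth b) {c : ℝ} {s : ℤ → ℂ}
    (h : DecayRate c s) (σ x₀ : ℝ) :
    AEStronglyMeasurable (modeSeries σ x₀ s b) (volume.restrict (strip (halfLine σ x₀))) := by
  refine aestronglyMeasurable_of_hasSum (f := fun k p => b k * mode σ x₀ (s k) k p)
    (fun k => (continuous_const.mul (continuous_mode σ x₀ (s k) k)).aestronglyMeasurable) ?_
  filter_upwards [ae_fst_mem_strip (measurableSet_halfLine σ x₀)] with p hp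
    using hasSum_modeSeries hb h hp

theorem memLp_modeSeries_slice {b : ℤ → ℂ} (hb : QuadGrowth b) {c : ℝ} {s : ℤ → ℂ}
    (h : DecayRate c s) {σ x₀ x : ℝ} (hx : x ∈ halfLine σ x₀) :
    MemLp (fun z => modeSeries σ x₀ s b (x, z)) 2 unitMeasure := by
  obtain ⟨B, hB, hBb⟩ := hb.exists_bound h σ x₀ (δ := σ * (x - x₀)) hx
  have hm : AEStronglyMeasurable (fun z => modeSeries σ x₀ s b (x, z)) unitMeasure :=
    aestronglyMeasurable_of_hasSum (f := fun k z => b k * mode σ x₀ (s k) k (x, z))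
      (fun k => (continuous_const.mul ((continuous_mode σ x₀ (s k) k).comp
        (Continuous.prodMk_right x))).aestronglyMeasurable)
      (ae_of_all _ fun z => hasSum_modeSeries hb h (p := (x, z)) hx)
  refine MemLp.of_bound hm (∑' k, B k) (ae_of_all _ fun z => ?_)
  exact tsum_of_norm_bounded hB.hasSum (hBb (x, z) le_rfl)

/-- Away from `x₀` the series is dominated uniformly in `z`, so it may be integrated termwise, and
orthogonality leaves one term. -/
theorem coefFun_modeSeries {b : ℤ → ℂ} (hb : QuadGrowth b) {c : ℝ} {s : ℤ → ℂ}
    (h : DecayRate c s) {σ x₀ x : ℝ} (hx : x ∈ halfLine σ x₀) (k : ℤ) :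
    coefFun (modeSeries σ x₀ s b) k x = b k * modeX σ x₀ (s k) x := by
  obtain ⟨B, hB, hBb⟩ := hb.exists_bound h σ x₀ (δ := σ * (x - x₀)) hx
  rw [coefFun, fourierCoef_eq]
  have hfun : ∀ (j : ℤ) (z : ℝ), b j * mode σ x₀ (s j) j (x, z) * expMode (-k) z =
      b j * modeX σ x₀ (s j) x * expMode (j + -k) z := fun j z => by
    rw [mode, ← expMode_mul]; ring
  have hs : HasSum (fun j => ∫ z, b j * mode σ x₀ (s j) j (x, z) * expMode (-k) z ∂unitMeasure)
      (∫ z, modeSeries σ x₀ s b (x, z) * expMode (-k) z ∂unitMeasure) := by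
    refine hasSum_integral_of_dominated_convergence (fun j _ => B j) (fun j => ?_) (fun j => ?_)
      (ae_of_all _ fun z => hB) (integrable_const _) (ae_of_all _ fun z => ?_)
    · simp only [hfun]
      exact (continuous_const.mul (continuous_expMode _)).aestronglyMeasurable
    · refine ae_of_all _ fun z => ?_
      rw [norm_mul, norm_expMode, mul_one]
      exact hBb (x, z) le_rfl j
    · exact (hasSum_modeSeries hb h (p := (x, z)) hx).mul_right _
  refine hs.unique ?_
  convert hasSum_ite_eq k (b k * modeX σ x₀ (s k) x) using 1
  funext j
  simp only [hfun]
  rw [integral_const_mul, integral_expMode, ← sub_eq_add_neg]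
  rcases eq_or_ne j k with rfl | hj
  · simp
  · simp [hj, sub_eq_zero]

theorem lintegral_modeX_sq {σ : ℝ} (hσ : σ = 1 ∨ σ = -1) (x₀ : ℝ) {s : ℂ} (hs : s.re < 0) :
    ∫⁻ x in halfLine σ x₀, ‖modeX σ x₀ s x‖ₑ ^ 2 = ENNReal.ofReal (1 / (2 * -s.re)) := by
  have e : ∀ x, ‖modeX σ x₀ s x‖ₑ ^ 2 =
      ENNReal.ofReal (Real.exp (-(2 * s.re * σ * x₀)) * Real.exp (2 * s.re * σ * x)) := fun x => by
    rw [← ofReal_norm, norm_modeX, ← ENNReal.ofReal_pow (Real.exp_pos _).le, ← Real.exp_nat_mul,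
      ← Real.exp_add]
    congr 2; push_cast; ring
  simp only [e]
  have key : IntegrableOn (fun x => Real.exp (2 * s.re * σ * x)) (halfLine σ x₀) ∧
      ∫ x in halfLine σ x₀, Real.exp (2 * s.re * σ * x) =
        Real.exp (2 * s.re * σ * x₀) / (2 * -s.re) := by
    rcases hσ with rfl | rfl
    · rw [halfLine_one]
      have ha : 2 * s.re * 1 < 0 := by linarith
      refine ⟨integrableOn_exp_mul_Ioi ha x₀, ?_⟩
      rw [integral_exp_mul_Ioi ha]
      field_simp
    · rw [halfLine_neg_one]
      have ha : 0 < 2 * s.re * -1 := by linarith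
      refine ⟨(integrableOn_exp_mul_Iic ha x₀).mono_set Iio_subset_Iic_self, ?_⟩
      rw [← integral_Iic_eq_integral_Iio, integral_exp_mul_Iic ha]
      congr 1; ring
  rw [← ofReal_integral_eq_lintegral_ofReal (key.1.const_mul _)
    (ae_of_all _ fun x => by positivity), integral_const_mul, key.2, mul_div_assoc', ← Real.exp_add]
  simp

/-- The gain of `1/⟨k⟩` is the half derivative which makes `H^{1/2}` the right space for the
boundary data. -/
theorem lintegral_modeX_sq_le {σ : ℝ} (hσ : σ = 1 ∨ σ = -1) (x₀ : ℝ) {c : ℝ} {s : ℤ → ℂ}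
    (h : DecayRate c s) (k : ℤ) :
    ∫⁻ x in halfLine σ x₀, ‖modeX σ x₀ (s k) x‖ₑ ^ 2 ≤ ENNReal.ofReal (1 / (2 * c) / jap k) := by
  have hc : 0 < c * jap k := mul_pos h.1 (jap_pos k)
  rw [lintegral_modeX_sq hσ x₀ (by linarith [h.2 k])]
  refine ENNReal.ofReal_le_ofReal ?_
  rw [div_div, mul_assoc]
  exact one_div_le_one_div_of_le (by positivity) (by linarith [h.2 k])

/-- The square integral over the strip of a series of modes. -/
theorem lintegral_modeSeries_sq_le {σ : ℝ} (hσ : σ = 1 ∨ σ = -1) (x₀ : ℝ) {b : ℤ → ℂ}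
    (hb : QuadGrowth b) {c : ℝ} {s : ℤ → ℂ} (h : DecayRate c s)
    (hsum : Summable fun k => ‖b k‖ ^ 2 / jap k) :
    ∫⁻ p in strip (halfLine σ x₀), ‖modeSeries σ x₀ s b p‖ₑ ^ 2 ≤
      ENNReal.ofReal (1 / (2 * c) * ∑' k, ‖b k‖ ^ 2 / jap k) := by
  have hc := h.1
  have hm := aestronglyMeasurable_modeSeries hb h σ x₀
  rw [restrict_strip] at hm ⊢
  rw [lintegral_prod _ (hm.enorm.pow_const 2)]
  -- Parseval on each slice; afterwards sum and `x`-integral are exchanged by Tonelli.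
  have e1 : ∫⁻ x in halfLine σ x₀, ∫⁻ z, ‖modeSeries σ x₀ s b (x, z)‖ₑ ^ 2 ∂unitMeasure =
      ∫⁻ x in halfLine σ x₀, ∑' k, ‖b k‖ₑ ^ 2 * ‖modeX σ x₀ (s k) x‖ₑ ^ 2 := by
    refine setLIntegral_congr_fun (measurableSet_halfLine σ x₀) fun x hx => ?_
    rw [lintegral_enorm_sq (memLp_modeSeries_slice hb h hx)]
    refine tsum_congr fun k => ?_
    have := coefFun_modeSeries hb h hx k
    rw [coefFun] at this
    rw [this, enorm_mul, mul_pow]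
  have hmeas : ∀ k, Measurable fun x => ‖modeX σ x₀ (s k) x‖ₑ ^ 2 := fun k =>
    (contDiff_modeX σ x₀ (s k)).continuous.measurable.enorm.pow_const 2
  rw [e1, lintegral_tsum fun k => ((hmeas k).const_mul _).aemeasurable, ← tsum_mul_left,
    ENNReal.ofReal_tsum_of_nonneg (fun k => by have := jap_pos k; positivity) (hsum.mul_left _)]
  refine ENNReal.tsum_le_tsum fun k => ?_
  rw [lintegral_const_mul _ (hmeas k)]
  calc ‖b k‖ₑ ^ 2 * ∫⁻ x in halfLine σ x₀, ‖modeX σ x₀ (s k) x‖ₑ ^ 2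
      ≤ ‖b k‖ₑ ^ 2 * ENNReal.ofReal (1 / (2 * c) / jap k) := by
        gcongr; exact lintegral_modeX_sq_le hσ x₀ h k
    _ = _ := by
      rw [← ofReal_norm, ← ENNReal.ofReal_pow (norm_nonneg _),
        ← ENNReal.ofReal_mul (sq_nonneg _)]
      congr 1; ring

theorem memLp_modeSeries {σ : ℝ} (hσ : σ = 1 ∨ σ = -1) (x₀ : ℝ) {b : ℤ → ℂ}
    (hb : QuadGrowth b) {c : ℝ} {s : ℤ → ℂ} (h : DecayRate c s)
    (hsum : Summable fun k => ‖b k‖ ^ 2 / jap k) :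
    MemLp (modeSeries σ x₀ s b) 2 (volume.restrict (strip (halfLine σ x₀))) :=
  memLp_two_of_lintegral_lt_top (aestronglyMeasurable_modeSeries hb h σ x₀)
    ((lintegral_modeSeries_sq_le hσ x₀ hb h hsum).trans_lt ENNReal.ofReal_lt_top)

theorem integral_modeSeries_sq_le {σ : ℝ} (hσ : σ = 1 ∨ σ = -1) (x₀ : ℝ) {b : ℤ → ℂ}
    (hb : QuadGrowth b) {c : ℝ} {s : ℤ → ℂ} (h : DecayRate c s)
    (hsum : Summable fun k => ‖b k‖ ^ 2 / jap k) :
    ∫ p in strip (halfLine σ x₀), ‖modeSeries σ x₀ s b p‖ ^ 2 ≤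
      1 / (2 * c) * ∑' k, ‖b k‖ ^ 2 / jap k := by
  have hc := h.1
  have hm := aestronglyMeasurable_modeSeries hb h σ x₀
  rw [integral_eq_lintegral_of_nonneg_ae (ae_of_all _ fun p => sq_nonneg _) (hm.norm.pow 2)]
  refine ENNReal.toReal_le_of_le_ofReal (mul_nonneg (by positivity)
    (tsum_nonneg fun k => by have := jap_pos k; positivity)) ?_
  refine le_of_eq_of_le ?_ (lintegral_modeSeries_sq_le hσ x₀ hb h hsum)
  refine lintegral_congr fun p => ?_
  rw [ENNReal.ofReal_pow (norm_nonneg _), ofReal_norm]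

/-! ### Testing series of modes -/

/-- Continuous functions supported in `K × ℝ` for a compact `K ⊆ I`. -/
def IsXCompact (I : Set ℝ) (ψ : ℝ × ℝ → ℂ) : Prop :=
  Continuous ψ ∧ ∃ K : Set ℝ, IsCompact K ∧ K ⊆ I ∧ ∀ x z, x ∉ K → ψ (x, z) = 0

/-- Smooth functions supported in `K × ℝ` for a compact `K ⊆ I`, with equal values at `z = 0` and
`z = 1`. -/
structure IsStripTest (I : Set ℝ) (φ : ℝ × ℝ → ℂ) : Prop where
  contDiff : ContDiff ℝ ∞ φ
  periodic : ∀ x, φ (x, 1) = φ (x, 0)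
  compact : ∃ K : Set ℝ, IsCompact K ∧ K ⊆ I ∧ ∀ x z, x ∉ K → φ (x, z) = 0

theorem IsTest.isStripTest {I : Set ℝ} {φ : ℝ × ℝ → ℂ} (h : IsTest I φ) : IsStripTest I φ :=
  ⟨h.1, fun x => by simpa using h.2.1 x 0, h.2.2⟩

/-- Compactly supported test functions vanish at `z = 0` and `z = 1`. One integration by parts thus
serves both the weak derivatives and the equation. -/
theorem isStripTest_of_tsupport_subset {I : Set ℝ} {φ : ℝ × ℝ → ℂ} (h : ContDiff ℝ ∞ φ)
    (hc : HasCompactSupport φ) (hs : tsupport φ ⊆ strip I) : IsStripTest I φ := by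
  have h0 : ∀ x z, z ∉ Ioo (0 : ℝ) 1 → φ (x, z) = 0 := fun x z hz =>
    image_eq_zero_of_notMem_tsupport fun hx => hz (hs hx).2
  refine ⟨h, fun x => by rw [h0 x 1 (by simp), h0 x 0 (by simp)],
    Prod.fst '' tsupport φ, hc.image continuous_fst, ?_, fun x z hx => ?_⟩
  · rintro _ ⟨p, hp, rfl⟩
    exact (hs hp).1
  · exact image_eq_zero_of_notMem_tsupport fun hx' => hx ⟨_, hx', rfl⟩

theorem IsStripTest.isXCompact {I : Set ℝ} {φ : ℝ × ℝ → ℂ} (h : IsStripTest I φ) :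
    IsXCompact I φ := ⟨h.contDiff.continuous, h.compact⟩

theorem IsStripTest.fderiv {I : Set ℝ} {φ : ℝ × ℝ → ℂ} (h : IsStripTest I φ) (v : ℝ × ℝ) :
    IsXCompact I fun p => fderiv ℝ φ p v := by
  refine ⟨(h.contDiff.continuous_fderiv (by simp)).clm_apply continuous_const, ?_⟩
  obtain ⟨K, hK, hKI, hK0⟩ := h.compact
  refine ⟨K, hK, hKI, fun x z hx => ?_⟩
  have : φ =ᶠ[𝓝 (x, z)] fun _ => 0 := by
    have ho : IsOpen (Prod.fst ⁻¹' Kᶜ : Set (ℝ × ℝ)) := hK.isClosed.isOpen_compl.preimage continuous_fst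
    filter_upwards [ho.mem_nhds (show (x, z) ∈ _ from hx)] with p hp using hK0 p.1 p.2 hp
  beta_reduce
  rw [this.fderiv_eq]; simp

theorem IsXCompact.integrable {I : Set ℝ} (hI : MeasurableSet I) {ψ : ℝ × ℝ → ℂ}
    (h : IsXCompact I ψ) : Integrable ψ (volume.restrict (strip I)) := by
  obtain ⟨hc, K, hK, -, hK0⟩ := h
  have h1 : IntegrableOn ψ (K ×ˢ Icc 0 1) :=
    hc.continuousOn.integrableOn_compact (hK.prod isCompact_Icc)
  refine h1.of_forall_sdiff_eq_zero (hI.prod measurableSet_Ioo) fun p hp => hK0 p.1 p.2 fun hpK => ?_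
  exact hp.2 ⟨hpK, Ioo_subset_Icc_self hp.1.2⟩

theorem IsXCompact.mul_left {I : Set ℝ} {ψ f : ℝ × ℝ → ℂ} (h : IsXCompact I ψ)
    (hf : Continuous f) : IsXCompact I fun p => f p * ψ p := by
  obtain ⟨hc, K, hK, hKI, hK0⟩ := h
  exact ⟨hf.mul hc, K, hK, hKI, fun x z hx => by simp only [hK0 x z hx, mul_zero]⟩

theorem IsXCompact.memLp {I : Set ℝ} (hI : MeasurableSet I) {ψ : ℝ × ℝ → ℂ}
    (h : IsXCompact I ψ) : MemLp ψ 2 (volume.restrict (strip I)) := by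
  rw [memLp_two_iff_integrable_sq_norm h.1.aestronglyMeasurable]
  have := ((h.mul_left h.1).integrable hI).norm
  simpa [sq] using this

theorem exists_pos_le_of_isCompact {σ x₀ : ℝ} {K : Set ℝ} (hK : IsCompact K)
    (hKI : K ⊆ halfLine σ x₀) : ∃ δ > 0, ∀ x ∈ K, δ ≤ σ * (x - x₀) := by
  rcases K.eq_empty_or_nonempty with rfl | hne
  · exact ⟨1, one_pos, by simp⟩
  obtain ⟨y, hy, hmin⟩ := hK.exists_isMinOn (f := fun x => σ * (x - x₀)) hne (by fun_prop)
  exact ⟨σ * (y - x₀), hKI hy, fun x hx => hmin hx⟩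

/-- The support of `ψ` keeps a positive distance from `x₀`, so `B k * ‖ψ p‖` dominates the terms.
Identities for the series therefore reduce to identities for single modes. -/
theorem hasSum_integral_modeSeries_mul {b : ℤ → ℂ} (hb : QuadGrowth b) {c : ℝ} {s : ℤ → ℂ}
    (h : DecayRate c s) {σ x₀ : ℝ} {ψ : ℝ × ℝ → ℂ} (hψ : IsXCompact (halfLine σ x₀) ψ) :
    HasSum (fun k => b k * ∫ p in strip (halfLine σ x₀), mode σ x₀ (s k) k p * ψ p)
      (∫ p in strip (halfLine σ x₀), modeSeries σ x₀ s b p * ψ p) := by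
  have hIm := measurableSet_halfLine σ x₀
  obtain ⟨K, hK, hKI, hK0⟩ := hψ.2
  obtain ⟨δ, hδ, hδK⟩ := exists_pos_le_of_isCompact hK hKI
  obtain ⟨B, hB, hBb⟩ := hb.exists_bound h σ x₀ hδ
  have hsm := hasSum_integral_of_dominated_convergence
    (μ := volume.restrict (strip (halfLine σ x₀)))
    (F := fun k p => b k * mode σ x₀ (s k) k p * ψ p)
    (f := fun p => modeSeries σ x₀ s b p * ψ p) (fun k p => B k * ‖ψ p‖)
    (fun k => ((continuous_const.mul (continuous_mode σ x₀ (s k) k)).mul hψ.1).aestronglyMeasurable)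
    (fun k => ae_of_all _ fun p => ?_) (ae_of_all _ fun p => hB.mul_right _) ?_ ?_
  · refine hsm.congr_fun fun k => ?_
    rw [← integral_const_mul]
    simp only [mul_assoc]
  · by_cases hp : p.1 ∈ K
    · rw [norm_mul]
      exact mul_le_mul_of_nonneg_right (hBb p (hδK _ hp) k) (norm_nonneg _)
    · have := hK0 p.1 p.2 hp
      simp [this]
  · simp only [tsum_mul_right]
    exact (hψ.integrable hIm).norm.const_mul _
  · filter_upwards [ae_fst_mem_strip hIm] with p hp
    exact (hasSum_modeSeries hb h hp).mul_right _

theorem hasDerivAt_slice_fst {φ : ℝ × ℝ → ℂ} (h : ContDiff ℝ ∞ φ) (x z : ℝ) :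
    HasDerivAt (fun x => φ (x, z)) (fderiv ℝ φ (x, z) (1, 0)) x :=
  (h.differentiable (by simp) (x, z)).hasFDerivAt.comp_hasDerivAt x
    ((hasDerivAt_id x).prodMk (hasDerivAt_const x z))

theorem hasDerivAt_slice_snd {φ : ℝ × ℝ → ℂ} (h : ContDiff ℝ ∞ φ) (x z : ℝ) :
    HasDerivAt (fun z => φ (x, z)) (fderiv ℝ φ (x, z) (0, 1)) z :=
  (h.differentiable (by simp) (x, z)).hasFDerivAt.comp_hasDerivAt z
    ((hasDerivAt_const z x).prodMk (hasDerivAt_id z))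

/-- Modes are smooth for all real `x` and `φ` vanishes outside a compact part of the half line, so
integration by parts takes place on the whole line without boundary terms. -/
theorem integral_mode_mul_fderiv_fst {σ x₀ : ℝ} {φ : ℝ × ℝ → ℂ}
    (hφ : IsStripTest (halfLine σ x₀) φ) (s : ℂ) (k : ℤ) :
    ∫ p in strip (halfLine σ x₀), mode σ x₀ s k p * fderiv ℝ φ p (1, 0) =
      -(σ * s * ∫ p in strip (halfLine σ x₀), mode σ x₀ s k p * φ p) := by
  have hIm := measurableSet_halfLine σ x₀
  have hφ' := hφ.fderiv (1, 0)
  have i1 := (hφ'.mul_left (continuous_mode σ x₀ s k)).integrable hIm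
  have i2 := (hφ.isXCompact.mul_left (continuous_mode σ x₀ s k)).integrable hIm
  rw [restrict_strip] at i1 i2 ⊢
  rw [integral_prod_symm _ i1, integral_prod_symm _ i2, ← integral_const_mul, ← integral_neg]
  refine integral_congr_ae (ae_of_all _ fun z => ?_)
  simp only
  obtain ⟨K, hK, hKI, hK0⟩ := hφ.compact
  obtain ⟨K', hK', hKI', hK0'⟩ := hφ'.2
  rw [setIntegral_eq_integral_of_forall_compl_eq_zero fun x hx => by
      exact mul_eq_zero_of_right _ (hK0' x z fun h => hx (hKI' h)),
    setIntegral_eq_integral_of_forall_compl_eq_zero fun x hx => by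
      rw [hK0 x z fun h => hx (hKI h), mul_zero], ← integral_const_mul, ← integral_neg]
  have hsl : Continuous fun x : ℝ => (x, z) := by fun_prop
  have c1 : HasCompactSupport fun x => φ (x, z) :=
    HasCompactSupport.intro hK fun x hx => hK0 x z hx
  have c2 : HasCompactSupport fun x => fderiv ℝ φ (x, z) (1, 0) :=
    HasCompactSupport.intro hK' fun x hx => hK0' x z hx
  have mc := (contDiff_modeX σ x₀ s).continuous
  have cφ : Continuous fun x => φ (x, z) := hφ.contDiff.continuous.comp hsl
  have cφ' : Continuous fun x => fderiv ℝ φ (x, z) (1, 0) := hφ'.1.comp hsl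
  have key := integral_mul_deriv_eq_deriv_mul_of_integrable (u := modeX σ x₀ s)
    (v := fun x => φ (x, z)) (u' := fun x => σ * s * modeX σ x₀ s x)
    (v' := fun x => fderiv ℝ φ (x, z) (1, 0))
    (fun x _ => hasDerivAt_modeX σ x₀ s x) (fun x _ => hasDerivAt_slice_fst hφ.contDiff x z)
    ((mc.mul cφ').integrable_of_hasCompactSupport c2.mul_left)
    (((continuous_const.mul mc).mul cφ).integrable_of_hasCompactSupport c1.mul_left)
    ((mc.mul cφ).integrable_of_hasCompactSupport c1.mul_left)
  calc ∫ x, mode σ x₀ s k (x, z) * fderiv ℝ φ (x, z) (1, 0)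
      = expMode k z * ∫ x, modeX σ x₀ s x * fderiv ℝ φ (x, z) (1, 0) := by
        rw [← integral_const_mul]
        refine integral_congr_ae (ae_of_all _ fun x => ?_)
        simp only [mode]; ring
    _ = _ := by
        rw [key, ← integral_neg, ← integral_const_mul]
        refine integral_congr_ae (ae_of_all _ fun x => ?_)
        simp only [mode]; ring

/-- The boundary terms at `z = 0` and `z = 1` cancel by periodicity of both factors. -/
theorem integral_mode_mul_fderiv_snd {σ x₀ : ℝ} {φ : ℝ × ℝ → ℂ}
    (hφ : IsStripTest (halfLine σ x₀) φ) (s : ℂ) (k : ℤ) :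
    ∫ p in strip (halfLine σ x₀), mode σ x₀ s k p * fderiv ℝ φ p (0, 1) =
      -(2 * Real.pi * Complex.I * k * ∫ p in strip (halfLine σ x₀), mode σ x₀ s k p * φ p) := by
  have hIm := measurableSet_halfLine σ x₀
  have hφ' := hφ.fderiv (0, 1)
  have i1 := (hφ'.mul_left (continuous_mode σ x₀ s k)).integrable hIm
  have i2 := (hφ.isXCompact.mul_left (continuous_mode σ x₀ s k)).integrable hIm
  rw [restrict_strip] at i1 i2 ⊢
  rw [integral_prod _ i1, integral_prod _ i2, ← integral_const_mul, ← integral_neg]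
  refine integral_congr_ae (ae_of_all _ fun x => ?_)
  simp only
  have hsl : Continuous fun z : ℝ => (x, z) := by fun_prop
  have key := intervalIntegral.integral_mul_deriv_eq_deriv_mul (a := 0) (b := 1)
    (u := expMode k) (v := fun z => φ (x, z)) (u' := fun z => 2 * Real.pi * Complex.I * k * expMode k z)
    (v' := fun z => fderiv ℝ φ (x, z) (0, 1))
    (fun z _ => hasDerivAt_expMode k z) (fun z _ => hasDerivAt_slice_snd hφ.contDiff x z)
    ((continuous_const.mul (continuous_expMode k)).intervalIntegrable 0 1)
    ((hφ'.1.comp hsl).intervalIntegrable 0 1)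
  rw [expMode_one, expMode_zero, hφ.periodic x, sub_self, zero_sub,
    intervalIntegral.integral_of_le zero_le_one, intervalIntegral.integral_of_le zero_le_one,
    integral_Ioc_eq_integral_Ioo, integral_Ioc_eq_integral_Ioo] at key
  calc ∫ z, mode σ x₀ s k (x, z) * fderiv ℝ φ (x, z) (0, 1) ∂unitMeasure
      = modeX σ x₀ s x * ∫ z, expMode k z * fderiv ℝ φ (x, z) (0, 1) ∂unitMeasure := by
        rw [← integral_const_mul]
        refine integral_congr_ae (ae_of_all _ fun x => ?_)
        simp only [mode]; ring
    _ = _ := by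
        rw [key, ← integral_neg, ← integral_const_mul, ← integral_const_mul, ← integral_neg]
        refine integral_congr_ae (ae_of_all _ fun x => ?_)
        simp only [mode]; ring

theorem integral_modeSeries_mul_fderiv_fst {b : ℤ → ℂ} {c : ℝ} {s : ℤ → ℂ} {σ x₀ : ℝ}
    (hb : QuadGrowth b) (hb' : QuadGrowth fun k => σ * s k * b k) (h : DecayRate c s)
    {φ : ℝ × ℝ → ℂ} (hφ : IsStripTest (halfLine σ x₀) φ) :
    ∫ p in strip (halfLine σ x₀), modeSeries σ x₀ s b p * fderiv ℝ φ p (1, 0) =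
      -∫ p in strip (halfLine σ x₀), modeSeries σ x₀ s (fun k => σ * s k * b k) p * φ p := by
  have h1 := hasSum_integral_modeSeries_mul hb h (hφ.fderiv (1, 0))
  have h2 := (hasSum_integral_modeSeries_mul hb' h hφ.isXCompact).neg
  refine h1.unique (h2.congr_fun fun k => ?_)
  rw [integral_mode_mul_fderiv_fst hφ]; ring

theorem integral_modeSeries_mul_fderiv_snd {b : ℤ → ℂ} {c : ℝ} {s : ℤ → ℂ} {σ x₀ : ℝ}
    (hb : QuadGrowth b) (hb' : QuadGrowth fun k => 2 * Real.pi * Complex.I * k * b k)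
    (h : DecayRate c s) {φ : ℝ × ℝ → ℂ} (hφ : IsStripTest (halfLine σ x₀) φ) :
    ∫ p in strip (halfLine σ x₀), modeSeries σ x₀ s b p * fderiv ℝ φ p (0, 1) =
      -∫ p in strip (halfLine σ x₀),
        modeSeries σ x₀ s (fun k => 2 * Real.pi * Complex.I * k * b k) p * φ p := by
  have h1 := hasSum_integral_modeSeries_mul hb h (hφ.fderiv (0, 1))
  have h2 := (hasSum_integral_modeSeries_mul hb' h hφ.isXCompact).neg
  refine h1.unique (h2.congr_fun fun k => ?_)
  rw [integral_mode_mul_fderiv_snd hφ]; ring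

/-! ### Traces -/

/-- By Parseval the squared distance of `u(x, ·)` to `f` is `∑ |f_k|² |exp(s_k σ (x - x₀)) - 1|²`,
with terms at most `4 |f_k|²`, so dominated convergence applies. It serves for the Dirichlet trace
of the constructed solution and for the trace of `σ w_x` of any solution. -/
theorem hasTraceX_of_coefFun {σ x₀ c : ℝ} {s : ℤ → ℂ} (h : DecayRate c s) {u : ℝ × ℝ → ℂ}
    (hu : MemLp u 2 (volume.restrict (strip (halfLine σ x₀)))) {f : ℝ → ℂ}
    (hf : MemLp f 2 unitMeasure)
    (hcoef : ∀ k, ∀ᵐ x ∂volume.restrict (halfLine σ x₀),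
      coefFun u k x = fourierCoef f k * modeX σ x₀ (s k) x) :
    HasTraceX (halfLine σ x₀) x₀ u f := by
  have hIm := measurableSet_halfLine σ x₀
  refine ⟨hf, ?_⟩
  set D : ℝ → ℤ → ℝ := fun x k => ‖fourierCoef f k * (modeX σ x₀ (s k) x - 1)‖ ^ 2 with hD
  have hfs := (hasSum_norm_sq_fourierCoef hf).summable
  have hDle : ∀ x ∈ halfLine σ x₀, ∀ k, D x k ≤ 4 * ‖fourierCoef f k‖ ^ 2 := fun x hx k => by
    have h1 : ‖modeX σ x₀ (s k) x‖ ≤ 1 := by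
      simpa using h.norm_modeX_le (σ := σ) (x₀ := x₀) (x := x) le_rfl (le_of_lt hx) k
    have h2 : ‖modeX σ x₀ (s k) x - 1‖ ≤ 2 := by
      refine (norm_sub_le _ _).trans ?_
      rw [norm_one]; linarith
    calc D x k = ‖fourierCoef f k‖ ^ 2 * ‖modeX σ x₀ (s k) x - 1‖ ^ 2 := by
          rw [hD]; simp only [norm_mul, mul_pow]
      _ ≤ ‖fourierCoef f k‖ ^ 2 * 2 ^ 2 := by gcongr
      _ = _ := by ring
  have hlim : Tendsto (fun x => ∑' k, D x k) (𝓝[halfLine σ x₀] x₀ ⊓ ae volume) (𝓝 0) := by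
    have := tendsto_tsum_of_dominated_convergence (f := D) (g := fun _ => 0)
      (𝓕 := 𝓝[halfLine σ x₀] x₀ ⊓ ae volume) (hfs.mul_left 4) (fun k => ?_) ?_
    · simpa using this
    · have t1 := (tendsto_modeX σ x₀ (s k)).mono_left
        ((inf_le_left (b := ae volume)).trans (nhdsWithin_le_nhds (s := halfLine σ x₀)))
      have t2 := (((t1.sub_const 1).const_mul (fourierCoef f k)).norm).pow 2
      simpa [hD] using t2
    · filter_upwards [eventually_nhdsWithin_inf_ae hIm (ae_restrict_mem hIm)] with x hx k
      rw [Real.norm_of_nonneg (sq_nonneg _)]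
      exact hDle x hx k
  have hlim' : Tendsto (fun x => (ENNReal.ofReal (∑' k, D x k)) ^ (1 / 2 : ℝ))
      (𝓝[halfLine σ x₀] x₀ ⊓ ae volume) (𝓝 0) := by
    have t1 := ENNReal.tendsto_ofReal hlim
    have t2 := (ENNReal.continuous_rpow_const (y := 1 / 2)).tendsto (ENNReal.ofReal 0)
    have t3 := t2.comp t1
    simpa [Function.comp_def] using t3
  refine hlim'.congr' ?_
  rw [restrict_strip] at hu
  filter_upwards [eventually_nhdsWithin_inf_ae hIm (ae_restrict_mem hIm),
    eventually_nhdsWithin_inf_ae hIm (ae_memLp_slice hu),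
    eventually_nhdsWithin_inf_ae hIm (ae_all_iff.2 hcoef)] with x hx hxm hxc
  have hsq : ENNReal.ofReal (∑' k, D x k) =
      eLpNorm (fun z => u (x, z) - f z) 2 unitMeasure ^ 2 := by
    have hp := lintegral_enorm_sq (hxm.sub hf)
    rw [eLpNorm_two_sq]
    refine Eq.trans ?_ hp.symm
    rw [ENNReal.ofReal_tsum_of_nonneg (fun k => sq_nonneg _)
      (Summable.of_nonneg_of_le (fun k => sq_nonneg _) (hDle x hx) (hfs.mul_left 4))]
    refine tsum_congr fun k => ?_
    have hk := hxc k
    rw [coefFun] at hk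
    rw [ENNReal.ofReal_pow (norm_nonneg _), ofReal_norm]
    congr 2
    rw [show ((fun z => u (x, z)) - f) = fun z => u (x, z) - f z from rfl, fourierCoef_sub hxm hf,
      hk]
    ring
  rw [hsq, ← ENNReal.rpow_natCast, ← ENNReal.rpow_mul]
  norm_num

theorem eLpNorm_le_tsum_of_hasSum {α : Type*} [MeasurableSpace α] {μ : Measure α}
    {f : ℤ → α → ℂ} {F : α → ℂ} (hf : ∀ k, AEStronglyMeasurable (f k) μ)
    (h : ∀ᵐ x ∂μ, HasSum (fun k => f k x) (F x)) :
    eLpNorm F 2 μ ≤ ∑' k, eLpNorm (f k) 2 μ := by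
  -- The Fatou-type bound is applied to a sequence, so the sum over finite sets is sampled along
  -- symmetric partial sums.
  have hT : Tendsto (fun n : ℕ => Finset.Icc (-(n : ℤ)) n) atTop atTop := by
    refine tendsto_atTop_finset_of_monotone (fun m n hmn => ?_) fun k => ⟨k.natAbs, ?_⟩
    · exact Finset.Icc_subset_Icc (by omega) (by omega)
    · rw [Finset.mem_Icc]; omega
  have h1 := Lp.eLpNorm_lim_le_liminf_eLpNorm (p := 2) (μ := μ)
    (f := fun (n : ℕ) => ∑ k ∈ Finset.Icc (-(n : ℤ)) n, f k)
    (fun n => Finset.aestronglyMeasurable_sum _ fun k _ => hf k) F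
    (h.mono fun x hx => by
      have := hx.comp hT
      simpa [Function.comp_def, Finset.sum_apply] using this)
  refine h1.trans (liminf_le_of_le (by isBoundedDefault) fun b hb => ?_)
  obtain ⟨n, hn⟩ := hb.exists
  exact hn.trans ((eLpNorm_sum_le (fun k _ => hf k) one_le_two).trans (ENNReal.sum_le_tsum _))

theorem eLpNorm_modeX_le {σ : ℝ} (hσ : σ = 1 ∨ σ = -1) (x₀ : ℝ) {c : ℝ} {s : ℤ → ℂ}
    (h : DecayRate c s) (k : ℤ) :
    eLpNorm (modeX σ x₀ (s k)) 2 (volume.restrict (halfLine σ x₀)) ≤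
      ENNReal.ofReal (Real.sqrt (1 / (2 * c) / jap k)) := by
  have hc := h.1
  have hj := jap_pos k
  refine (ENNReal.pow_le_pow_left_iff two_ne_zero).1 ?_
  rw [eLpNorm_two_sq, ← ENNReal.ofReal_pow (Real.sqrt_nonneg _), Real.sq_sqrt (by positivity)]
  exact lintegral_modeX_sq_le hσ x₀ h k

/-- The term is the product of `⟨k⟩^{1/2} |b_k|` and `√a ⟨k⟩⁻¹`, both square summable. Hence for
`H^{1/2}` data the mode series at fixed `z` converges absolutely in `L²` of the half line, which
provides the traces in `z`. -/
theorem summable_norm_mul_sqrt {b : ℤ → ℂ} (hb : Summable fun k => jap k * ‖b k‖ ^ 2) {a : ℝ}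
    (ha : 0 ≤ a) : Summable fun k => ‖b k‖ * Real.sqrt (a / jap k) := by
  refine Summable.of_nonneg_of_le (fun k => by positivity) (fun k => ?_)
    (hb.add (summable_jap_inv_sq.mul_left a))
  have hj := jap_pos k
  have h1 : ‖b k‖ * Real.sqrt (a / jap k) =
      (Real.sqrt (jap k) * ‖b k‖) * (Real.sqrt a * (jap k)⁻¹) := by
    rw [Real.sqrt_div ha]
    have := Real.mul_self_sqrt hj.le
    field_simp
    rw [sq, this]
  have e1 : (Real.sqrt (jap k) * ‖b k‖) ^ 2 = jap k * ‖b k‖ ^ 2 := by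
    rw [mul_pow, Real.sq_sqrt hj.le]
  have e2 : (Real.sqrt a * (jap k)⁻¹) ^ 2 = a * (jap k ^ 2)⁻¹ := by
    rw [mul_pow, Real.sq_sqrt ha, inv_pow]
  rw [h1, ← e1, ← e2]
  nlinarith [sq_nonneg (Real.sqrt (jap k) * ‖b k‖ - Real.sqrt a * (jap k)⁻¹),
    sq_nonneg (Real.sqrt (jap k) * ‖b k‖), sq_nonneg (Real.sqrt a * (jap k)⁻¹)]

/-- Series of modes have traces at the horizontal boundary parts. -/
theorem hasTraceZ_modeSeries {σ : ℝ} (hσ : σ = 1 ∨ σ = -1) (x₀ : ℝ) {b : ℤ → ℂ}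
    (hb : QuadGrowth b) {c : ℝ} {s : ℤ → ℂ} (h : DecayRate c s)
    (hsum : Summable fun k => jap k * ‖b k‖ ^ 2) {z₀ : ℝ} (hz₀ : ∀ k, expMode k z₀ = 1) :
    HasTraceZ (halfLine σ x₀) z₀ (modeSeries σ x₀ s b) fun x => modeSeries σ x₀ s b (x, 0) := by
  have hc := h.1
  have hIm := measurableSet_halfLine σ x₀
  set A : ℤ → ℝ := fun k => ‖b k‖ * Real.sqrt (1 / (2 * c) / jap k) with hA
  have hAs : Summable A := summable_norm_mul_sqrt hsum (by positivity)
  have hA0 : ∀ k, 0 ≤ A k := fun k => by positivity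
  have hmc : ∀ k, AEStronglyMeasurable (modeX σ x₀ (s k)) (volume.restrict (halfLine σ x₀)) :=
    fun k => (contDiff_modeX σ x₀ (s k)).continuous.aestronglyMeasurable
  -- Applied twice: with `e_k = exp(2πik·0)` to bound the trace itself, and with `e_k = exp(2πikz) -
  -- 1` to bound the distance to the trace.
  have key : ∀ (F : ℝ → ℂ) (e : ℤ → ℂ), (∃ M : ℝ, ∀ k, ‖e k‖ ≤ M) →
      (∀ x ∈ halfLine σ x₀, HasSum (fun k => b k * e k * modeX σ x₀ (s k) x) (F x)) →
      eLpNorm F 2 (volume.restrict (halfLine σ x₀)) ≤ ENNReal.ofReal (∑' k, A k * ‖e k‖) := by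
    rintro F e ⟨M, hM⟩ hF
    have hs : Summable fun k => A k * ‖e k‖ :=
      Summable.of_nonneg_of_le (fun k => mul_nonneg (hA0 k) (norm_nonneg _))
        (fun k => mul_le_mul_of_nonneg_left (hM k) (hA0 k)) (hAs.mul_right M)
    rw [ENNReal.ofReal_tsum_of_nonneg (fun k => mul_nonneg (hA0 k) (norm_nonneg _)) hs]
    refine (eLpNorm_le_tsum_of_hasSum (f := fun k x => b k * e k * modeX σ x₀ (s k) x)
      (fun k => (hmc k).const_mul _) ?_).trans (ENNReal.tsum_le_tsum fun k => ?_)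
    · filter_upwards [ae_restrict_mem hIm] with x hx using hF x hx
    · have e1 : (fun x => b k * e k * modeX σ x₀ (s k) x) = (b k * e k) • modeX σ x₀ (s k) := rfl
      rw [e1, eLpNorm_const_smul, ← ofReal_norm]
      calc _ ≤ ENNReal.ofReal ‖b k * e k‖ *
            ENNReal.ofReal (Real.sqrt (1 / (2 * c) / jap k)) := by
            gcongr; exact eLpNorm_modeX_le hσ x₀ h k
        _ = _ := by
            rw [← ENNReal.ofReal_mul (norm_nonneg _), norm_mul, hA]
            congr 1; ring
  have hser : ∀ x ∈ halfLine σ x₀, ∀ z, HasSum (fun k => b k * expMode k z * modeX σ x₀ (s k) x)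
      (modeSeries σ x₀ s b (x, z)) := fun x hx z =>
    (hasSum_modeSeries hb h (p := (x, z)) hx).congr_fun fun k => by rw [mode]; ring
  have htm : AEStronglyMeasurable (fun x => modeSeries σ x₀ s b (x, 0))
      (volume.restrict (halfLine σ x₀)) := by
    refine aestronglyMeasurable_of_hasSum (f := fun k x => b k * expMode k 0 * modeX σ x₀ (s k) x)
      (fun k => (hmc k).const_mul _) ?_
    filter_upwards [ae_restrict_mem hIm] with x hx using hser x hx 0
  refine ⟨⟨htm, ?_⟩, ?_⟩
  · exact (key _ (fun k => expMode k 0) ⟨1, fun k => by simp⟩ fun x hx => hser x hx 0).trans_lt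
      ENNReal.ofReal_lt_top
  · have hlim : Tendsto (fun z => ENNReal.ofReal (∑' k, A k * ‖expMode k z - 1‖)) (𝓝 z₀) (𝓝 0) := by
      rw [← ENNReal.ofReal_zero]
      refine ENNReal.tendsto_ofReal ?_
      have := tendsto_tsum_of_dominated_convergence (f := fun z k => A k * ‖expMode k z - 1‖)
        (g := fun _ => 0) (𝓕 := 𝓝 z₀) (hAs.mul_right 2) (fun k => ?_) ?_
      · simpa using this
      · have t := (((continuous_expMode k).tendsto z₀).sub_const 1).norm.const_mul (A k)
        simpa [hz₀ k] using t
      · refine Eventually.of_forall fun z k => ?_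
        rw [Real.norm_of_nonneg (mul_nonneg (hA0 k) (norm_nonneg _))]
        refine mul_le_mul_of_nonneg_left ((norm_sub_le _ _).trans ?_) (hA0 k)
        rw [norm_expMode, norm_one]; norm_num
    refine tendsto_of_tendsto_of_tendsto_of_le_of_le' tendsto_const_nhds
      (hlim.mono_left (inf_le_left.trans nhdsWithin_le_nhds))
      (Eventually.of_forall fun _ => zero_le) (Eventually.of_forall fun z => ?_)
    refine key _ (fun k => expMode k z - 1) ⟨2, fun k => ?_⟩ fun x hx => ?_
    · refine (norm_sub_le _ _).trans ?_
      rw [norm_expMode, norm_one]; norm_num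
    · refine ((hser x hx z).sub (hser x hx 0)).congr_fun fun k => ?_
      rw [expMode_zero]; ring

/-! ### Well-posedness of the exterior problem -/

theorem quadGrowth_mul {a b : ℤ → ℂ} {C M : ℝ} (hC : 0 ≤ C) (hM : ∀ k, ‖b k‖ ≤ M)
    (ha : ∀ k, ‖a k‖ ≤ C * jap k ^ 2) : QuadGrowth fun k => a k * b k := by
  have hM0 : 0 ≤ M := (norm_nonneg _).trans (hM 0)
  refine ⟨C * M, mul_nonneg hC hM0, fun k => ?_⟩
  rw [norm_mul]
  calc ‖a k‖ * ‖b k‖ ≤ (C * jap k ^ 2) * M :=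
        mul_le_mul (ha k) (hM k) (norm_nonneg _) (by positivity)
    _ = _ := by ring

theorem jap_le_sq (k : ℤ) : jap k ≤ jap k ^ 2 := by nlinarith [one_le_jap k]

/-- If `‖a_k‖ ≤ C ⟨k⟩`, then `a_k b_k ∈ H^{-1/2}` whenever `b ∈ H^{1/2}`. -/
theorem norm_mul_sq_div_jap_le {a b : ℤ → ℂ} {C : ℝ} (ha : ∀ k, ‖a k‖ ≤ C * jap k) (k : ℤ) :
    ‖a k * b k‖ ^ 2 / jap k ≤ C ^ 2 * (jap k * ‖b k‖ ^ 2) := by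
  have hj := jap_pos k
  rw [div_le_iff₀ hj, norm_mul, mul_pow]
  calc ‖a k‖ ^ 2 * ‖b k‖ ^ 2 ≤ (C * jap k) ^ 2 * ‖b k‖ ^ 2 := by gcongr; exact ha k
    _ = _ := by ring

theorem summable_norm_mul_sq_div_jap {a b : ℤ → ℂ} {C : ℝ} (ha : ∀ k, ‖a k‖ ≤ C * jap k)
    (hb : Summable fun k => jap k * ‖b k‖ ^ 2) : Summable fun k => ‖a k * b k‖ ^ 2 / jap k :=
  Summable.of_nonneg_of_le (fun k => by have := jap_pos k; positivity)
    (norm_mul_sq_div_jap_le ha) (hb.mul_left _)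

theorem integral_modeSeries_mul_sq_le {σ : ℝ} (hσ : σ = 1 ∨ σ = -1) (x₀ : ℝ) {a b : ℤ → ℂ}
    (hab : QuadGrowth fun k => a k * b k) {c C : ℝ} {s : ℤ → ℂ} (h : DecayRate c s)
    (ha : ∀ k, ‖a k‖ ≤ C * jap k) (hb : Summable fun k => jap k * ‖b k‖ ^ 2) :
    ∫ p in strip (halfLine σ x₀), ‖modeSeries σ x₀ s (fun k => a k * b k) p‖ ^ 2 ≤
      1 / (2 * c) * (C ^ 2 * ∑' k, jap k * ‖b k‖ ^ 2) := by
  have hc := h.1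
  have hs := summable_norm_mul_sq_div_jap ha hb
  refine (integral_modeSeries_sq_le hσ x₀ hab h hs).trans ?_
  rw [← tsum_mul_left (a := C ^ 2)]
  gcongr
  · exact hb.mul_left _
  · exact norm_mul_sq_div_jap_le ha _

theorem norm_ofReal_sign {σ : ℝ} (hσ : σ = 1 ∨ σ = -1) : ‖(σ : ℂ)‖ = 1 := by
  rcases hσ with rfl | rfl <;> simp

theorem exists_isExteriorSolution {σ : ℝ} (hσ : σ = 1 ∨ σ = -1) (x₀ κ : ℝ) {γ : ℂ} (hre : γ.re ≠ 0)
    (him : ∀ n : ℤ, γ.im ≠ 2 * Real.pi * n) :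
    ∃ C : ℝ, ∀ g : ℝ → ℂ, MemHs (1 / 2) g → ∃ w : H1 (strip (halfLine σ x₀)),
      IsExteriorSolution (halfLine σ x₀) x₀ κ γ g w ∧ w.norm ≤ C * hsNorm (1 / 2) g := by
  obtain ⟨c, hc, hcs⟩ := exists_sCoef_re_le (κ := κ) hre him
  obtain ⟨C, hC, hCs⟩ := exists_norm_sCoef_le (κ := κ) hre him
  set s : ℤ → ℂ := sCoef κ γ with hsdef
  have h : DecayRate c s := ⟨hc, hcs⟩
  have hIm := measurableSet_halfLine σ x₀
  -- The summands `1`, `C ^ 2`, `1` come from `w`, `w_x` and `w_z`, whose coefficients are `g_k`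
  -- times factors bounded by `⟨k⟩`, `C⟨k⟩` and `⟨k⟩`.
  refine ⟨Real.sqrt (1 / (2 * c) * (1 + C ^ 2 + 1)), fun g hg => ?_⟩
  set b : ℤ → ℂ := fourierCoef g with hbdef
  have hsum : Summable fun k => jap k * ‖b k‖ ^ 2 := by
    have := hg.2
    simpa only [funext (hsTerm_half g)] using this
  set M := (eLpNorm g 2 unitMeasure).toReal with hMdef
  have hM : ∀ k, ‖b k‖ ≤ M := fun k => by
    rw [← toReal_enorm]
    exact ENNReal.toReal_mono hg.1.2.ne (enorm_fourierCoef_le hg.1 k)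
  have one_le : ∀ k : ℤ, ‖(1 : ℂ)‖ ≤ 1 * jap k := fun k => by simpa using one_le_jap k
  have s_le : ∀ k, ‖(σ : ℂ) * s k‖ ≤ C * jap k := fun k => by
    rw [norm_mul, norm_ofReal_sign hσ, one_mul]; exact hCs k
  have e_le : ∀ k : ℤ, ‖(2 * Real.pi * Complex.I * k : ℂ)‖ ≤ 1 * jap k := fun k => by
    rw [one_mul]; exact norm_two_pi_I_le_jap k
  have up : ∀ {a : ℤ → ℂ} {C' : ℝ}, 0 ≤ C' → (∀ k, ‖a k‖ ≤ C' * jap k) →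
      QuadGrowth (fun k => a k * b k) ∧ QuadGrowth fun k => a k * (a k * b k) := by
    intro a C' hC' ha
    refine ⟨quadGrowth_mul hC' hM fun k => (ha k).trans ?_, ?_⟩
    · exact mul_le_mul_of_nonneg_left (jap_le_sq k) hC'
    · have := quadGrowth_mul (a := fun k => a k * a k) (C := C' ^ 2) (sq_nonneg _) hM fun k => by
        rw [norm_mul, ← mul_pow, ← sq]
        exact pow_le_pow_left₀ (norm_nonneg _) (ha k) 2
      simpa only [mul_assoc] using this
  have hb1 : (fun k => (1 : ℂ) * b k) = b := by funext k; rw [one_mul]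
  have q0 : QuadGrowth b := by simpa using (up zero_le_one one_le).1
  obtain ⟨qx, qxx⟩ := up hC.le s_le
  obtain ⟨qz, qzz⟩ := up zero_le_one e_le
  have m0 : MemLp (modeSeries σ x₀ s b) 2 (volume.restrict (strip (halfLine σ x₀))) :=
    memLp_modeSeries hσ x₀ q0 h (by simpa using summable_norm_mul_sq_div_jap one_le hsum)
  have mx := memLp_modeSeries hσ x₀ qx h (summable_norm_mul_sq_div_jap s_le hsum)
  have mz := memLp_modeSeries hσ x₀ qz h (summable_norm_mul_sq_div_jap e_le hsum)
  let w : H1 (strip (halfLine σ x₀)) :=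
    { val := modeSeries σ x₀ s b
      dx := modeSeries σ x₀ s fun k => σ * s k * b k
      dz := modeSeries σ x₀ s fun k => 2 * Real.pi * Complex.I * k * b k
      memLp_val := m0
      memLp_dx := mx
      memLp_dz := mz
      weak_dx := fun φ hφ hφc hφs => integral_modeSeries_mul_fderiv_fst q0 qx h
        (isStripTest_of_tsupport_subset hφ hφc hφs)
      weak_dz := fun φ hφ hφc hφs => integral_modeSeries_mul_fderiv_snd q0 qz h
        (isStripTest_of_tsupport_subset hφ hφc hφs) }
  refine ⟨w, ⟨fun φ hφ => ?_, ?_, ?_⟩, ?_⟩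
  · have hφ := hφ.isStripTest
    have pφ := hφ.isXCompact.memLp hIm
    have i1 : Integrable (fun p => w.dx p * fderiv ℝ φ p (1, 0)) _ :=
      mx.integrable_mul ((hφ.fderiv (1, 0)).memLp hIm)
    have i2 : Integrable (fun p => w.dz p * fderiv ℝ φ p (0, 1)) _ :=
      mz.integrable_mul ((hφ.fderiv (0, 1)).memLp hIm)
    have i3 : Integrable (fun p => w.dz p * φ p) _ := mz.integrable_mul pφ
    have i4 : Integrable (fun p => w.val p * φ p) _ := m0.integrable_mul pφ
    have e1 : ∫ p in strip (halfLine σ x₀), w.dx p * fderiv ℝ φ p (1, 0) = _ :=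
      integral_modeSeries_mul_fderiv_fst qx qxx h hφ
    have e2 : ∫ p in strip (halfLine σ x₀), w.dz p * fderiv ℝ φ p (0, 1) = _ :=
      integral_modeSeries_mul_fderiv_snd qz qzz h hφ
    have hsplit : ∫ p in strip (halfLine σ x₀), (-(w.dx p * fderiv ℝ φ p (1, 0)) -
        w.dz p * fderiv ℝ φ p (0, 1) + 2 * γ * w.dz p * φ p +
        (γ ^ 2 + (κ : ℂ) ^ 2) * w.val p * φ p) =
        -(∫ p in strip (halfLine σ x₀), w.dx p * fderiv ℝ φ p (1, 0)) -
        (∫ p in strip (halfLine σ x₀), w.dz p * fderiv ℝ φ p (0, 1)) +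
        2 * γ * (∫ p in strip (halfLine σ x₀), w.dz p * φ p) +
        (γ ^ 2 + (κ : ℂ) ^ 2) * ∫ p in strip (halfLine σ x₀), w.val p * φ p := by
      rw [sub_eq_add_neg, add_assoc, ← neg_add, ← integral_add i1 i2,
        ← add_assoc, ← integral_neg_add_mul_add_mul (i1.fun_add i2) i3 i4]
      refine integral_congr_ae (ae_of_all _ fun p => ?_)
      simp only; ring
    rw [hsplit, e1, e2, neg_neg, sub_neg_eq_add]
    have t1 := hasSum_integral_modeSeries_mul qxx h hφ.isXCompact
    have t2 := hasSum_integral_modeSeries_mul qzz h hφ.isXCompact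
    have t3 := (hasSum_integral_modeSeries_mul qz h hφ.isXCompact).mul_left (2 * γ)
    have t4 := (hasSum_integral_modeSeries_mul q0 h hφ.isXCompact).mul_left (γ ^ 2 + (κ : ℂ) ^ 2)
    refine (((t1.add t2).add t3).add t4).unique (hasSum_zero.congr_fun fun k => ?_)
    have hs2 : s k ^ 2 = -beta κ γ k := sCoef_sq (beta_im_ne_zero hre him k)
    have hσ2 : (σ : ℂ) ^ 2 = 1 := by rcases hσ with rfl | rfl <;> simp
    rw [beta] at hs2
    -- Term by term the equation reads `σ² s_k² + β_k = 0`.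
    linear_combination (b k * ∫ p in strip (halfLine σ x₀), mode σ x₀ (s k) k p * φ p) *
      (hs2 + s k ^ 2 * hσ2)
  · exact ⟨_, hasTraceZ_modeSeries hσ x₀ q0 h hsum expMode_zero,
      hasTraceZ_modeSeries hσ x₀ q0 h hsum expMode_one⟩
  · refine hasTraceX_of_coefFun h m0 hg.1 fun k => ?_
    filter_upwards [ae_restrict_mem hIm] with x hx using coefFun_modeSeries q0 h hx k
  · have n0 := integral_modeSeries_mul_sq_le hσ x₀ (by rwa [hb1]) h one_le hsum
    have nx := integral_modeSeries_mul_sq_le hσ x₀ qx h s_le hsum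
    have nz := integral_modeSeries_mul_sq_le hσ x₀ qz h e_le hsum
    rw [hb1] at n0
    rw [H1.norm, hsNorm, ← Real.sqrt_mul (by positivity)]
    refine Real.sqrt_le_sqrt ?_
    rw [funext (hsTerm_half g)]
    calc _ ≤ _ := add_le_add (add_le_add n0 nx) nz
      _ = _ := by ring

/-- On almost every slice all Fourier coefficients of both solutions are the same explicit
exponentials. The index set is countable, so the exceptional null sets can be united. -/
theorem IsExteriorSolution.ae_eq {σ : ℝ} (hσ : σ = 1 ∨ σ = -1) {x₀ κ : ℝ} {γ : ℂ} (hre : γ.re ≠ 0)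
    (him : ∀ n : ℤ, γ.im ≠ 2 * Real.pi * n) {g : ℝ → ℂ} {w w' : H1 (strip (halfLine σ x₀))}
    (h : IsExteriorSolution (halfLine σ x₀) x₀ κ γ g w)
    (h' : IsExteriorSolution (halfLine σ x₀) x₀ κ γ g w') :
    w'.val =ᵐ[volume.restrict (strip (halfLine σ x₀))] w.val := by
  have m := w.memLp_val
  have m' := w'.memLp_val
  rw [restrict_strip] at m m' ⊢
  have hcoef : ∀ᵐ x ∂volume.restrict (halfLine σ x₀), ∀ k,
      coefFun w'.val k x = coefFun w.val k x := ae_all_iff.2 fun k => by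
    have hβ := beta_im_ne_zero (κ := κ) hre him k
    filter_upwards [(h.coefFun_ae_eq hσ hβ).1, (h'.coefFun_ae_eq hσ hβ).1] with x h1 h2
    rw [h1, h2]
  have hm : AEMeasurable (fun p => ‖w'.val p - w.val p‖ₑ ^ 2)
      ((volume.restrict (halfLine σ x₀)).prod unitMeasure) := (m'.1.sub m.1).enorm.pow_const 2
  have h0 : ∫⁻ p, ‖w'.val p - w.val p‖ₑ ^ 2
      ∂((volume.restrict (halfLine σ x₀)).prod unitMeasure) = 0 := by
    rw [lintegral_prod _ hm]
    refine lintegral_eq_zero_of_ae_eq_zero ?_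
    filter_upwards [hcoef, ae_memLp_slice m, ae_memLp_slice m'] with x hx hx1 hx2
    refine lintegral_eq_zero_of_ae_eq_zero ?_
    filter_upwards [ae_eq_of_fourierCoef_eq hx2 hx1 hx] with z hz
    simp [hz]
  filter_upwards [(lintegral_eq_zero_iff' hm).1 h0] with p hp
  simpa [sub_eq_zero] using hp

theorem exterior_wellPosed {σ : ℝ} (hσ : σ = 1 ∨ σ = -1) (x₀ κ : ℝ) {γ : ℂ} (hre : γ.re ≠ 0)
    (him : ∀ n : ℤ, γ.im ≠ 2 * Real.pi * n) :
    ∃ C : ℝ, ∀ g : ℝ → ℂ, MemHs (1 / 2) g → ∃ w : H1 (strip (halfLine σ x₀)),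
      IsExteriorSolution (halfLine σ x₀) x₀ κ γ g w ∧
      (∀ w' : H1 (strip (halfLine σ x₀)), IsExteriorSolution (halfLine σ x₀) x₀ κ γ g w' →
        w'.val =ᵐ[volume.restrict (strip (halfLine σ x₀))] w.val) ∧
      w.norm ≤ C * hsNorm (1 / 2) g := by
  obtain ⟨C, hC⟩ := exists_isExteriorSolution hσ x₀ κ hre him
  refine ⟨C, fun g hg => ?_⟩
  obtain ⟨w, hw, hn⟩ := hC g hg
  exact ⟨w, hw, fun w' hw' => hw.ae_eq hσ hre him hw', hn⟩

/-! ### The Dirichlet-to-Neumann map -/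

/-- The factor `s_k` costs one power of `⟨k⟩`, which is why `g ∈ H¹` is required. -/
theorem summable_norm_sq_sCoef_mul (κ : ℝ) {γ : ℂ} (hre : γ.re ≠ 0)
    (him : ∀ n : ℤ, γ.im ≠ 2 * Real.pi * n) {g : ℝ → ℂ} (hg : MemHs 1 g) :
    Summable fun k => ‖sCoef κ γ k * fourierCoef g k‖ ^ 2 := by
  obtain ⟨C, -, hCs⟩ := exists_norm_sCoef_le (κ := κ) hre him
  refine Summable.of_nonneg_of_le (fun k => sq_nonneg _) (fun k => ?_) (hg.2.mul_left (C ^ 2))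
  rw [hsTerm_one, norm_mul, mul_pow]
  calc ‖sCoef κ γ k‖ ^ 2 * ‖fourierCoef g k‖ ^ 2 ≤ (C * jap k) ^ 2 * ‖fourierCoef g k‖ ^ 2 := by
        gcongr; exact hCs k
    _ = _ := by ring

theorem summable_dtnTerm (κ : ℝ) {γ : ℂ} (hre : γ.re ≠ 0)
    (him : ∀ n : ℤ, γ.im ≠ 2 * Real.pi * n) {g : ℝ → ℂ} (hg : MemHs 1 g) :
    Summable (dtnTerm κ γ g) :=
  summable_smul_expMode (summable_norm_sq_sCoef_mul κ hre him hg)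

/-- The coefficients of `σ w_x` are `σ² s_k g_k exp(s_k σ (x - x₀))` with `σ² = 1`, so
`hasTraceX_of_coefFun` applies with the Dirichlet-to-Neumann image as limit. The factor `σ` produces
the minus sign on the left half strip. Any representative `w₀` of the trace has the coefficients of
`g`. -/
theorem IsExteriorSolution.hasTraceX_dx {σ : ℝ} (hσ : σ = 1 ∨ σ = -1) {x₀ κ : ℝ} {γ : ℂ}
    (hre : γ.re ≠ 0) (him : ∀ n : ℤ, γ.im ≠ 2 * Real.pi * n) {g : ℝ → ℂ} (hg : MemHs 1 g)
    {w : H1 (strip (halfLine σ x₀))} (h : IsExteriorSolution (halfLine σ x₀) x₀ κ γ g w)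
    {w₀ : ℝ → ℂ} (hw₀ : HasTraceX (halfLine σ x₀) x₀ w.val w₀) :
    HasTraceX (halfLine σ x₀) x₀ (fun p => σ * w.dx p) (dtn κ γ w₀) := by
  have hIm := measurableSet_halfLine σ x₀
  obtain ⟨c, hc, hcs⟩ := exists_sCoef_re_le (κ := κ) hre him
  have := neBot_nhdsWithin_inf_ae (isOpen_halfLine σ x₀) (mem_closure_halfLine hσ x₀)
  have hw₀g : ∀ k, fourierCoef w₀ k = fourierCoef g k := fun k =>
    tendsto_nhds_unique (tendsto_coefFun hIm w.memLp_val hw₀ k)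
      (tendsto_coefFun hIm w.memLp_val h.dirichlet k)
  have hs : Summable fun k => ‖sCoef κ γ k * fourierCoef w₀ k‖ ^ 2 := by
    simpa only [hw₀g] using summable_norm_sq_sCoef_mul κ hre him hg
  refine hasTraceX_of_coefFun ⟨hc, hcs⟩ (w.memLp_dx.const_mul _) (Lp.memLp _) fun k => ?_
  have hdtn : fourierCoef (dtn κ γ w₀) k = sCoef κ γ k * fourierCoef w₀ k :=
    fourierCoef_tsum_smul_expMode hs k
  have hσ2 : (σ : ℂ) ^ 2 = 1 := by rcases hσ with rfl | rfl <;> simp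
  filter_upwards [(h.coefFun_ae_eq hσ (beta_im_ne_zero hre him k)).2] with x hx
  have e : coefFun (fun p => σ * w.dx p) k x = σ * coefFun w.dx k x := by
    simp only [coefFun, fourierCoef_eq, mul_assoc, integral_const_mul]
  rw [e, hx, hdtn, hw₀g]
  linear_combination (sCoef κ γ k * fourierCoef g k * modeX σ x₀ (sCoef κ γ k) x) * hσ2

end Waveguide

end

open Waveguide in
/-- `xm`, `xp` are `x₋`, `x₊`, and `κm`, `κp` are `κ₋`, `κ₊`. -/
theorem mainTheorem3 (xm xp κm κp : ℝ) (γ : ℂ) (hre : γ.re ≠ 0)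
    (him : ∀ n : ℤ, γ.im ≠ 2 * Real.pi * n) :
    -- well-posedness of the exterior problem on `S₊`
    (∃ C : ℝ, ∀ g : ℝ → ℂ, MemHs (1 / 2) g →
      ∃ w : H1 (strip (Ioi xp)), IsExteriorSolution (Ioi xp) xp κp γ g w ∧
        (∀ w' : H1 (strip (Ioi xp)), IsExteriorSolution (Ioi xp) xp κp γ g w' →
          w'.val =ᵐ[volume.restrict (strip (Ioi xp))] w.val) ∧
        w.norm ≤ C * hsNorm (1 / 2) g) ∧
    -- well-posedness of the exterior problem on `S₋`
    (∃ C : ℝ, ∀ g : ℝ → ℂ, MemHs (1 / 2) g →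
      ∃ w : H1 (strip (Iio xm)), IsExteriorSolution (Iio xm) xm κm γ g w ∧
        (∀ w' : H1 (strip (Iio xm)), IsExteriorSolution (Iio xm) xm κm γ g w' →
          w'.val =ᵐ[volume.restrict (strip (Iio xm))] w.val) ∧
        w.norm ≤ C * hsNorm (1 / 2) g) ∧
    -- the Dirichlet-to-Neumann maps
    (∀ g : ℝ → ℂ, MemHs 1 g →
      Summable (dtnTerm κp γ g) ∧ Summable (dtnTerm κm γ g) ∧
      (∀ w : H1 (strip (Ioi xp)), IsExteriorSolution (Ioi xp) xp κp γ g w →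
        ∀ w₀ : ℝ → ℂ, HasTraceX (Ioi xp) xp w.val w₀ →
          HasTraceX (Ioi xp) xp w.dx (dtn κp γ w₀)) ∧
      (∀ w : H1 (strip (Iio xm)), IsExteriorSolution (Iio xm) xm κm γ g w →
        ∀ w₀ : ℝ → ℂ, HasTraceX (Iio xm) xm w.val w₀ →
          HasTraceX (Iio xm) xm (fun p => -w.dx p) (dtn κm γ w₀))) := by
  have hp : (1 : ℝ) = 1 ∨ (1 : ℝ) = -1 := Or.inl rfl
  have hm : (-1 : ℝ) = 1 ∨ (-1 : ℝ) = -1 := Or.inr rfl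
  -- Both half strips are instances of the same statements, with `σ = 1` and `σ = -1`.
  rw [← halfLine_one xp, ← halfLine_neg_one xm]
  refine ⟨exterior_wellPosed hp xp κp hre him, exterior_wellPosed hm xm κm hre him, fun g hg =>
    ⟨summable_dtnTerm κp hre him hg, summable_dtnTerm κm hre him hg, fun w hw w₀ hw₀ => ?_,
      fun w hw w₀ hw₀ => ?_⟩⟩
  · simpa using hw.hasTraceX_dx hp hre him hg hw₀
  · simpa using hw.hasTraceX_dx hm hre him hg hw₀
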